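/- Let $p>0$ be a prime number, let $K$ be a field of characteristic $p$, and let $G$ be a finitely generated subgroup of $K^*\times K^*$ (with coordinatewise multiplication) of rank $r=\dim_{\mathbb{Q}}(G\otimes_{\mathbb{Z}}\mathbb{Q})$. Write $G^p=\{g^p : g\in G\}$. Then the equation $$x+y=1,\qquad (x,y)\in G,$$ has at most $31\cdot 19^{r}$ solutions $(x,y)$ satisfying $(x,y)\notin G^p$. -/

import Mathlib

open scoped TensorProduct

/-! ### Padé approximants in characteristic `p` -/

section

open Polynomial

/-! The method is a gap principle followed by sphere packing. `exists_isProperFamily` puts the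
coordinates of generators of `G` in a subfield of `K` carrying nonarchimedean absolute values with a
product formula. Only a finite set `S` of them is nontrivial on `G`, so each solution has a
logarithmic vector in a real space of dimension at most `r`, and a height `logHt`. A solution of
height zero has finite order, so it is a `p`-th power in `G` and is excluded; the others can be
divided by their heights.

Let (x, y) and (s, t) be distinct solutions outside `G^p`, of heights h₁ ≤ h₂, with nearly equal
normalized vectors. Padé polynomials satisfying X^(2N+1) A + (1-X)^(2N+1) B + C = 0 yield the form l
= s/x^n B(x) - t/y^n A(x), n = 2N+1. If l ≠ 0, the product formula bounds (N+1)h₁ by the height of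
(s/x^n, t/y^n), which is small when h₂ is near n h₁. If l = 0, then s is a rational function of x of
degree 3N+1 and (3N+1)h₁ ≤ h₂. Both also hold with x, y replaced by their p^k-th powers, since
Frobenius preserves x + y = 1. The Wronskian argument needs 3N+1 < p; this range suffices to confine
h₂/h₁ to [16/9, 9/4]·p^k for some k, with p > 3 (`exists_pow_mul_le_of_gap`).

Such ratios are not stable under composition, so three solutions cannot be pairwise close
(`not_three_ratios`). Normalized vectors have norm at most 3, and a ball of radius 1/6 about any
point contains at most two of them; comparing volumes gives 2(1 + 3·6)^r = 2·19^r, below the stated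
bound. -/

theorem Polynomial.exists_pade_nonzero (k : Type*) [Field k] (N : ℕ) :
    ∃ A B C : k[X], A.natDegree ≤ N ∧ B.natDegree ≤ N ∧ C.natDegree ≤ N ∧
      ¬ (A = 0 ∧ B = 0) ∧ X ^ (2 * N + 1) * A + (1 - X) ^ (2 * N + 1) * B + C = 0 := by
  -- Coefficients N+1, ..., 3N+1 of the combination must vanish: 2N+1 linear conditions on the 2N+2
  -- coefficients of A and B.
  let φ : (degreeLT k (N + 1) × degreeLT k (N + 1)) →ₗ[k] (Fin (2 * N + 1) → k) :=
    LinearMap.pi fun i =>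
      (lcoeff k (N + 1 + i)) ∘ₗ
        (((LinearMap.mulLeft k (X ^ (2 * N + 1) : k[X])).comp (degreeLT k (N + 1)).subtype).coprod
          ((LinearMap.mulLeft k ((1 - X) ^ (2 * N + 1) : k[X])).comp
            (degreeLT k (N + 1)).subtype))
  have hfin : Module.finrank k (degreeLT k (N + 1)) = N + 1 := by
    rw [(degreeLTEquiv k (N + 1)).finrank_eq]; simp
  have : Module.Finite k (degreeLT k (N + 1)) := Module.Finite.equiv (degreeLTEquiv k (N + 1)).symm
  have hker : LinearMap.ker φ ≠ ⊥ := by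
    apply LinearMap.ker_ne_bot_of_finrank_lt
    rw [Module.finrank_prod, hfin]
    simp; omega
  obtain ⟨⟨A, B⟩, hAB, hne⟩ := (Submodule.ne_bot_iff _).1 hker
  have hdeg : ∀ P : degreeLT k (N + 1), (P : k[X]).natDegree ≤ N := fun P => by
    have := mem_degreeLT.1 P.2
    rw [natDegree_le_iff_degree_le]
    exact Order.le_of_lt_succ (by exact_mod_cast this)
  refine ⟨A, B, -(X ^ (2 * N + 1) * (A : k[X]) + (1 - X) ^ (2 * N + 1) * (B : k[X])), hdeg A, hdeg B, ?_, ?_,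
    by ring⟩
  · rw [natDegree_neg, natDegree_le_iff_coeff_eq_zero]
    intro j hj
    by_cases hj' : j < 3 * N + 2
    · have := congrFun (LinearMap.mem_ker.1 hAB) ⟨j - (N + 1), by omega⟩
      simpa [φ, show N + 1 + (j - (N + 1)) = j by omega] using this
    · apply coeff_eq_zero_of_natDegree_lt
      have h1 : ((1 - X : k[X]) ^ (2 * N + 1)).natDegree ≤ 2 * N + 1 := by
        refine natDegree_pow_le_of_le _ (m := 1) ?_ |>.trans (by omega)
        compute_degree
      have h2 := natDegree_add_le_of_le
        (natDegree_mul_le_of_le (natDegree_X_pow_le (R := k) (2 * N + 1)) (hdeg A))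
        (natDegree_mul_le_of_le h1 (hdeg B))
      refine h2.trans_lt ?_
      rw [max_self]; omega
  · rintro ⟨h1, h2⟩
    exact hne (Prod.ext (Subtype.ext h1) (Subtype.ext h2))

theorem Polynomial.pow_dvd_wronskian {k : Type*} [Field k] (t : k[X]) (n : ℕ) (A C : k[X]) :
    t ^ n ∣ wronskian (t ^ (n + 1) * A) C := by
  rw [wronskian, derivative_mul, derivative_pow]
  simp only [Nat.add_sub_cancel]
  refine dvd_sub ⟨t * A * derivative C, by ring⟩ ?_
  exact ⟨(C * ((n + 1 : ℕ) : k[X]) * derivative t * A + C * t * derivative A), by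
    simp only [map_natCast]; ring⟩

/-- The factor of `t` lost by differentiating `t ^ (n + 1)` is recovered from `C`. For t = X and t =
1 - X this extra factor overshoots the degree of the Wronskian, so neither divides the Padé
polynomial `C`. -/
theorem Polynomial.pow_succ_dvd_wronskian {k : Type*} [Field k] (t : k[X]) (n : ℕ) (A C : k[X])
    (h : t ∣ C) : t ^ (n + 1) ∣ wronskian (t ^ (n + 1) * A) C := by
  obtain ⟨D, rfl⟩ := h
  rw [wronskian, derivative_mul (f := t ^ (n + 1)), derivative_pow]
  simp only [Nat.add_sub_cancel]
  refine dvd_sub ⟨A * derivative (t * D), by ring⟩ ?_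
  exact ⟨D * ((n + 1 : ℕ) : k[X]) * derivative t * A + t * D * derivative A, by
    simp only [map_natCast]; ring⟩

/-- In characteristic `p`, polynomials of degree less than `p` with vanishing Wronskian are
linearly dependent. -/
theorem Polynomial.exists_smul_eq_of_wronskian_eq_zero {k : Type*} [Field k] (p : ℕ) [CharP k p]
    {f g : k[X]} (hf : f.natDegree < p) (hg : g.natDegree < p) (h : wronskian f g = 0) :
    ∃ a b : k, ¬ (a = 0 ∧ b = 0) ∧ C a * f = C b * g := by
  by_cases hf0 : f = 0
  · exact ⟨1, 0, by simp, by simp [hf0]⟩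
  have hconst : ∀ q : k[X], q.natDegree < p → derivative q = 0 → ∃ c, q = C c := by
    intro q hq hd
    refine ⟨q.coeff 0, ?_⟩
    ext j
    rcases j with _ | j
    · simp
    · rw [coeff_C_succ]
      by_cases hj : j + 1 < p
      · have := congrArg (fun r => coeff r j) hd
        simp only [coeff_derivative, coeff_zero, mul_eq_zero] at this
        refine this.resolve_right fun h0 => ?_
        have h1 : ((j + 1 : ℕ) : k) = 0 := by exact_mod_cast h0
        exact absurd (Nat.le_of_dvd (by omega) ((CharP.cast_eq_zero_iff k p _).1 h1)) (by omega)
      · exact coeff_eq_zero_of_natDegree_lt (by omega)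
  classical
  have hd0 : EuclideanDomain.gcd f g ≠ 0 := fun h0 =>
    hf0 (EuclideanDomain.gcd_eq_zero_iff.1 h0).1
  obtain ⟨f₀, hf₀⟩ := EuclideanDomain.gcd_dvd_left f g
  obtain ⟨g₀, hg₀⟩ := EuclideanDomain.gcd_dvd_right f g
  set d := EuclideanDomain.gcd f g with hd
  have hcop : IsCoprime f₀ g₀ := by
    refine ⟨EuclideanDomain.gcdA f g, EuclideanDomain.gcdB f g, mul_left_cancel₀ hd0 ?_⟩
    have := EuclideanDomain.gcd_eq_gcd_ab f g
    rw [← hd] at this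
    calc d * (EuclideanDomain.gcdA f g * f₀ + EuclideanDomain.gcdB f g * g₀)
        = (d * f₀) * EuclideanDomain.gcdA f g + (d * g₀) * EuclideanDomain.gcdB f g := by ring
      _ = d * 1 := by rw [← hf₀, ← hg₀, ← this, mul_one]
  have hw : wronskian f₀ g₀ = 0 := by
    have : d ^ 2 * wronskian f₀ g₀ = wronskian f g := by
      rw [hf₀, hg₀, wronskian, wronskian, derivative_mul, derivative_mul]; ring
    rw [h] at this
    exact (mul_eq_zero.1 this).resolve_left (pow_ne_zero 2 hd0)
  obtain ⟨h1, h2⟩ := hcop.wronskian_eq_zero_iff.1 hw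
  have hdeg : ∀ q r : k[X], r = d * q → r.natDegree < p → q.natDegree < p := by
    rintro q r rfl hr
    by_cases hq : q = 0
    · simpa [hq] using hr
    · rw [natDegree_mul hd0 hq] at hr; omega
  obtain ⟨a, ha⟩ := hconst f₀ (hdeg _ _ hf₀ hf) h1
  obtain ⟨b, hb⟩ := hconst g₀ (hdeg _ _ hg₀ hg) h2
  refine ⟨b, a, ?_, ?_⟩
  · rintro ⟨rfl, rfl⟩
    exact hf0 (by rw [hf₀, ha]; simp)
  · rw [hf₀, hg₀, ha, hb]; ring

theorem Polynomial.eq_zero_of_mul_eq_of_natDegree_lt {k : Type*} [Field k] {t A C : k[X]}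
    (hC : C.natDegree < t.natDegree) (h : t * A = C) : A = 0 ∧ C = 0 := by
  have hC0 : C = 0 := by
    by_contra h0
    have hA : A ≠ 0 := by rintro rfl; simp at h; exact h0 h.symm
    have ht : t ≠ 0 := by rintro rfl; simp at hC
    rw [← h, natDegree_mul ht hA] at hC
    omega
  refine ⟨?_, hC0⟩
  rw [hC0] at h
  refine (mul_eq_zero.1 h).resolve_left ?_
  rintro rfl; simp at hC

/-- Padé approximants to the pair `(X ^ (2 * N + 1), (1 - X) ^ (2 * N + 1))` at the three points
`0`, `1`, `∞`, in characteristic `p > 3 * N + 1`. -/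
theorem Polynomial.exists_pade {k : Type*} [Field k] (p : ℕ) [CharP k p] (N : ℕ)
    (hN : 3 * N + 1 < p) :
    ∃ A B C : k[X], A.natDegree = N ∧ B.natDegree ≤ N ∧ C.natDegree ≤ N ∧
      X ^ (2 * N + 1) * A + (1 - X) ^ (2 * N + 1) * B + C = 0 ∧ A ≠ 0 ∧
      IsCoprime (X ^ (2 * N + 1) * A) C := by
  obtain ⟨A, B, C, hA, hB, hC, hne, hrel⟩ := exists_pade_nonzero k N
  have hY1 : (1 - X : k[X]).natDegree = 1 := by
    rw [← natDegree_neg, neg_sub, ← C_1, natDegree_X_sub_C]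
  have hY0 : (1 - X : k[X]) ≠ 0 := by intro h; rw [h] at hY1; simp at hY1
  have hYn : ((1 - X : k[X]) ^ (2 * N + 1)).natDegree = 2 * N + 1 := by
    rw [natDegree_pow, hY1, mul_one]
  have hXn : ((X : k[X]) ^ (2 * N + 1)).natDegree = 2 * N + 1 := natDegree_X_pow _
  have hcop : IsCoprime (X : k[X]) (1 - X) := ⟨1, 1, by ring⟩
  have hfdeg : (X ^ (2 * N + 1) * A).natDegree ≤ 3 * N + 1 :=
    (natDegree_mul_le_of_le hXn.le hA).trans (by omega)
  set f := X ^ (2 * N + 1) * A with hf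
  set g := (1 - X) ^ (2 * N + 1) * B with hg
  have hWfg : wronskian f C = wronskian C g := by
    have hC' : C = -(f + g) := (neg_eq_of_add_eq_zero_right hrel).symm
    rw [hC', wronskian, wronskian, derivative_neg, derivative_add]; ring
  have hWX : X ^ (2 * N) ∣ wronskian f C := pow_dvd_wronskian _ _ _ _
  have hWY : (1 - X) ^ (2 * N) ∣ wronskian f C := by
    rw [hWfg, ← wronskian_neg_eq, dvd_neg]; exact pow_dvd_wronskian _ _ _ _
  -- The bound 3N+1 < p enters here: a zero Wronskian makes f and C proportional, and comparing
  -- degrees then kills both A and B.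
  have hWne : wronskian f C ≠ 0 := by
    intro hW
    obtain ⟨a, b, hab, h⟩ := exists_smul_eq_of_wronskian_eq_zero p
      (hfdeg.trans_lt hN) (show C.natDegree < p by omega) hW
    have h' : X ^ (2 * N + 1) * (Polynomial.C a * A) = Polynomial.C b * C := by
      rw [← h, hf]; ring
    obtain ⟨h1, h2⟩ := eq_zero_of_mul_eq_of_natDegree_lt (by
      rw [hXn]
      exact (natDegree_C_mul_le _ _).trans_lt (by omega)) h'
    have hAC : A = 0 ∨ C = 0 := by
      rcases mul_eq_zero.1 h1 with ha | ha
      · rcases mul_eq_zero.1 h2 with hb | hb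
        · exact absurd ⟨by simpa using ha, by simpa using hb⟩ hab
        · exact Or.inr hb
      · exact Or.inl ha
    rcases hAC with h0 | h0
    · have : (1 - X) ^ (2 * N + 1) * B = -C := by
        rw [← hg, eq_neg_iff_add_eq_zero, ← hrel, hf, h0]; ring
      exact hne ⟨h0, (eq_zero_of_mul_eq_of_natDegree_lt (by
        rw [hYn, natDegree_neg]; omega) this).1⟩
    · have h3 : (1 - X) ^ (2 * N + 1) ∣ X ^ (2 * N + 1) * A :=
        ⟨-B, by rw [mul_neg, ← hg, eq_neg_iff_add_eq_zero, ← hrel, h0, hf]; ring⟩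
      obtain ⟨D, hD⟩ := (hcop.symm.pow (m := 2 * N + 1) (n := 2 * N + 1)).dvd_of_dvd_mul_left h3
      obtain ⟨-, hA0⟩ := eq_zero_of_mul_eq_of_natDegree_lt (by rw [hYn]; omega) hD.symm
      refine hne ⟨hA0, ?_⟩
      have : (1 - X) ^ (2 * N + 1) * B = 0 := by
        rw [← hg, ← hrel, hf, hA0, h0]; ring
      exact (mul_eq_zero.1 this).resolve_left (pow_ne_zero _ hY0)
  have hWdeg : (wronskian f C).natDegree < f.natDegree + C.natDegree :=
    natDegree_wronskian_lt_add hWne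
  have hWtwo : ∀ i j : ℕ, X ^ i ∣ wronskian f C → (1 - X) ^ j ∣ wronskian f C →
      i + j ≤ (wronskian f C).natDegree := fun i j hi hj => by
    have := natDegree_le_of_dvd ((hcop.pow (m := i) (n := j)).mul_dvd hi hj) hWne
    rwa [natDegree_mul (pow_ne_zero _ X_ne_zero) (pow_ne_zero _ hY0), natDegree_X_pow,
      natDegree_pow, hY1, mul_one] at this
  have h4N := hWtwo _ _ hWX hWY
  have hA0 : A ≠ 0 := by
    rintro rfl
    exact hWne (by rw [hf, mul_zero, wronskian_zero_left])
  have hfdeg' : f.natDegree = 2 * N + 1 + A.natDegree := by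
    rw [hf, natDegree_mul (pow_ne_zero _ X_ne_zero) hA0, hXn]
  -- The chain 4N ≤ deg W < (2N+1 + deg A) + deg C ≤ 4N+1 leaves no slack, so deg A = N.
  refine ⟨A, B, C, by omega, hB, hC, hrel, hA0, ?_⟩
  refine isCoprime_of_irreducible_dvd ?_ fun z hz hzf hzC => ?_
  · rintro ⟨-, rfl⟩
    exact hWne (wronskian_zero_right _)
  have hXC : ¬ X ∣ C := fun h => by
    have := hWtwo _ _ (pow_succ_dvd_wronskian X (2 * N) A C h) hWY
    omega
  have hYC : ¬ (1 - X) ∣ C := fun h => by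
    have hd : (1 - X) ^ (2 * N + 1) ∣ wronskian f C := by
      rw [hWfg, ← wronskian_neg_eq, dvd_neg]; exact pow_succ_dvd_wronskian _ _ _ _ h
    have := hWtwo _ _ hWX hd
    omega
  have hcopz : ∀ t : k[X], Irreducible t → ¬ t ∣ C → IsCoprime z t := fun t ht htC => by
    refine (EuclideanDomain.dvd_or_coprime z t hz).resolve_left fun hdvd => htC ?_
    exact ((hz.associated_of_dvd ht hdvd).symm.dvd).trans hzC
  have hYirr : Irreducible (1 - X : k[X]) :=
    irreducible_of_degree_eq_one (by rw [degree_eq_natDegree hY0, hY1]; rfl)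
  have hzW : z ∣ wronskian f C := by
    rw [wronskian]
    exact dvd_sub (dvd_mul_of_dvd_left hzf _) (dvd_mul_of_dvd_right hzC _)
  -- A common factor z of f and C is prime to X(1-X) and divides W, so deg W would exceed 4N.
  have hzXY : IsCoprime z (X ^ (2 * N) * (1 - X) ^ (2 * N)) :=
    ((hcopz X irreducible_X hXC).pow_right).mul_right ((hcopz _ hYirr hYC).pow_right)
  have := natDegree_le_of_dvd (hzXY.mul_dvd hzW
    ((hcop.pow (m := 2 * N) (n := 2 * N)).mul_dvd hWX hWY)) hWne
  rw [natDegree_mul hz.ne_zero (mul_ne_zero (pow_ne_zero _ X_ne_zero) (pow_ne_zero _ hY0)),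
    natDegree_mul (pow_ne_zero _ X_ne_zero) (pow_ne_zero _ hY0), natDegree_X_pow,
    natDegree_pow, hY1] at this
  have := hz.natDegree_pos
  omega

end

/-! ### Packing and the rank of the group -/

open MeasureTheory Metric in
/-- If every point lies in at most `m` of the balls of radius `ρ` around finitely many points of
norm at most `R`, then the number of these points is at most `m (1 + R / ρ) ^ dim E`. -/
theorem card_le_of_forall_card_ball_le {E : Type*} [NormedAddCommGroup E] [NormedSpace ℝ E]
    [FiniteDimensional ℝ E] {ι : Type*} (S : Finset ι) (c : ι → E) {R ρ : ℝ} (hR : 0 ≤ R)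
    (hρ : 0 < ρ) (hc : ∀ i ∈ S, ‖c i‖ ≤ R) (m : ℕ)
    (hm : ∀ x : E, ∀ T ⊆ S, (∀ i ∈ T, x ∈ ball (c i) ρ) → T.card ≤ m) :
    (S.card : ℝ) ≤ m * (1 + R / ρ) ^ Module.finrank ℝ E := by
  classical
  borelize E
  let μ : Measure E := Measure.addHaar
  have hball : ∀ i, μ (ball (c i) ρ) = ENNReal.ofReal (ρ ^ Module.finrank ℝ E) * μ (ball 0 1) :=
    fun i => Measure.addHaar_ball_of_pos μ _ hρ
  have hbig : μ (ball (0 : E) (R + ρ)) =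
      ENNReal.ofReal ((R + ρ) ^ Module.finrank ℝ E) * μ (ball 0 1) :=
    Measure.addHaar_ball_of_pos μ _ (by positivity)
  -- The small balls all lie in the ball of radius R + ρ about 0 and cover each point at most m
  -- times; integration compares volumes.
  have hpt : ∀ x : E, ∑ i ∈ S, (ball (c i) ρ).indicator (fun _ => (1 : ENNReal)) x ≤
      (ball (0 : E) (R + ρ)).indicator (fun _ => (m : ENNReal)) x := by
    intro x
    have h1 : ∑ i ∈ S, (ball (c i) ρ).indicator (fun _ => (1 : ENNReal)) x =
        ((S.filter fun i => x ∈ ball (c i) ρ).card : ENNReal) := by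
      simp [Set.indicator_apply, Finset.sum_boole]
    rw [h1]
    have h2 := hm x (S.filter fun i => x ∈ ball (c i) ρ) (Finset.filter_subset _ _)
      (fun i hi => (Finset.mem_filter.1 hi).2)
    by_cases hx : x ∈ ball (0 : E) (R + ρ)
    · rw [Set.indicator_of_mem hx]
      exact_mod_cast h2
    · rw [Set.indicator_of_notMem hx, Finset.filter_false_of_mem, Finset.card_empty, Nat.cast_zero]
      intro i hi hxi
      apply hx
      rw [mem_ball, dist_zero_right]
      rw [mem_ball, dist_eq_norm] at hxi
      calc ‖x‖ = ‖c i + (x - c i)‖ := by congr 1; abel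
        _ ≤ ‖c i‖ + ‖x - c i‖ := norm_add_le _ _
        _ < R + ρ := add_lt_add_of_le_of_lt (hc i hi) hxi
  have hint := lintegral_mono (μ := μ) hpt
  rw [lintegral_finsetSum _ fun i _ => measurable_const.indicator measurableSet_ball] at hint
  simp only [lintegral_indicator measurableSet_ball, lintegral_const, Measure.restrict_apply_univ,
    one_mul, hball, hbig, Finset.sum_const, nsmul_eq_mul] at hint
  have hpos : μ (ball (0 : E) 1) ≠ 0 := (measure_ball_pos μ _ one_pos).ne'
  have hfin : μ (ball (0 : E) 1) ≠ ⊤ := measure_ball_lt_top.ne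
  rw [← mul_assoc, ← mul_assoc, ENNReal.mul_le_mul_iff_left hpos hfin] at hint
  rw [← ENNReal.ofReal_natCast, ← ENNReal.ofReal_natCast, ← ENNReal.ofReal_mul (by positivity),
    ← ENNReal.ofReal_mul (by positivity), ENNReal.ofReal_le_ofReal_iff (by positivity)] at hint
  have h3 : (1 + R / ρ) ^ Module.finrank ℝ E =
      (R + ρ) ^ Module.finrank ℝ E / ρ ^ Module.finrank ℝ E := by
    rw [← div_pow]; congr 1; field_simp; ring
  rw [h3, ← mul_div_assoc, le_div_iff₀ (by positivity)]
  exact hint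

/-- The real span of the image of a finitely generated abelian group under a homomorphism to a
real vector space has dimension at most the rank of the group. -/
theorem finrank_span_range_le_finrank_rat_tensorProduct {A E : Type*} [AddCommGroup A]
    [Module.Finite ℤ A] [AddCommGroup E] [Module ℝ E] (f : A →+ E) :
    Module.finrank ℝ (Submodule.span ℝ (Set.range f)) ≤ Module.finrank ℚ (ℚ ⊗[ℤ] A) ∧
      FiniteDimensional ℝ (Submodule.span ℝ (Set.range f)) := by
  let _ : Module ℚ E := Module.compHom E (algebraMap ℚ ℝ)
  have hsm : ∀ (q : ℚ) (e : E), q • e = (q : ℝ) • e := fun q e => rfl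
  let g : ℚ ⊗[ℤ] A →ₗ[ℚ] E := f.toIntLinearMap.liftBaseChange ℚ
  have hg : ∀ a, g (1 ⊗ₜ a) = f a := fun a => by
    simp [g, LinearMap.liftBaseChange_tmul]
  let b := Module.finBasis ℚ (ℚ ⊗[ℤ] A)
  have hle : Submodule.span ℝ (Set.range f) ≤ Submodule.span ℝ (Set.range (g ∘ b)) := by
    rw [Submodule.span_le]
    rintro _ ⟨a, rfl⟩
    rw [← hg, ← b.sum_repr (1 ⊗ₜ a), map_sum]
    refine Submodule.sum_mem _ fun i _ => ?_
    rw [map_smul, hsm]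
    exact Submodule.smul_mem _ _ (Submodule.subset_span ⟨i, rfl⟩)
  have hfin : FiniteDimensional ℝ (Submodule.span ℝ (Set.range (g ∘ b))) :=
    FiniteDimensional.span_of_finite ℝ (Set.finite_range _)
  refine ⟨(Submodule.finrank_mono hle).trans ?_, Submodule.finiteDimensional_of_le hle⟩
  have := finrank_range_le_card (R := ℝ) (g ∘ b)
  rwa [Fintype.card_fin] at this

/-! ### Local estimates at one nonarchimedean place -/

theorem AbsoluteValue.apply_sum_le_of_isNonarchimedean {K ι : Type*} [Field K]
    {v : AbsoluteValue K ℝ} (hv : IsNonarchimedean v) {c : ℝ} (hc : 0 ≤ c) (s : Finset ι)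
    (f : ι → K) (h : ∀ i ∈ s, v (f i) ≤ c) : v (∑ i ∈ s, f i) ≤ c := by
  classical
  induction s using Finset.induction_on with
  | empty => simpa using hc
  | insert i s hi ih =>
    rw [Finset.sum_insert hi]
    exact (hv _ _).trans (max_le (h i (by simp)) (ih fun j hj => h j (by simp [hj])))

theorem AbsoluteValue.apply_algebraMap_eq_one {k K : Type*} [Field k] [Finite k] [Field K]
    [Algebra k K] (v : AbsoluteValue K ℝ) {c : k} (hc : c ≠ 0) : v (algebraMap k K c) = 1 := by
  have := Fintype.ofFinite k
  have h := FiniteField.pow_card_sub_one_eq_one c hc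
  have h2 : v (algebraMap k K c) ^ (Fintype.card k - 1) = 1 := by
    rw [← map_pow, ← map_pow, h, map_one, map_one]
  have hcard := Fintype.one_lt_card (α := k)
  exact (pow_eq_one_iff_of_nonneg (v.nonneg _) (by omega)).1 h2

theorem AbsoluteValue.apply_algebraMap_le_one {k K : Type*} [Field k] [Finite k] [Field K]
    [Algebra k K] (v : AbsoluteValue K ℝ) (c : k) : v (algebraMap k K c) ≤ 1 := by
  by_cases hc : c = 0
  · simp [hc]
  · exact (v.apply_algebraMap_eq_one hc).le

section

open Polynomial

variable {k K : Type*} [Field k] [Finite k] [Field K] [Algebra k K] {v : AbsoluteValue K ℝ}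

theorem AbsoluteValue.apply_aeval_le (hv : IsNonarchimedean v) (x : K) {A : k[X]} {N : ℕ}
    (hA : A.natDegree ≤ N) : v (aeval x A) ≤ max 1 (v x) ^ N := by
  rw [aeval_eq_sum_range]
  refine apply_sum_le_of_isNonarchimedean hv (by positivity) _ _ fun i hi => ?_
  rw [Algebra.smul_def, map_mul, map_pow]
  have hi' : i ≤ N := by have := Finset.mem_range.1 hi; omega
  calc v (algebraMap k K (A.coeff i)) * v x ^ i ≤ 1 * max 1 (v x) ^ i := by
        gcongr
        · exact v.apply_algebraMap_le_one _
        · exact le_max_right _ _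
    _ ≤ max 1 (v x) ^ N := by
        rw [one_mul]; exact pow_le_pow_right₀ (le_max_left _ _) hi'

theorem AbsoluteValue.apply_aeval_eq_pow (hv : IsNonarchimedean v) {x : K} (hx : 1 < v x)
    {A : k[X]} (hA : A ≠ 0) : v (aeval x A) = v x ^ A.natDegree := by
  rw [← eraseLead_add_C_mul_X_pow A, map_add, map_mul, aeval_C, map_pow, aeval_X,
    eraseLead_add_C_mul_X_pow]
  have hlead : v (algebraMap k K A.leadingCoeff * x ^ A.natDegree) = v x ^ A.natDegree := by
    rw [map_mul, v.apply_algebraMap_eq_one (leadingCoeff_ne_zero.2 hA), one_mul, map_pow]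
  have hlt : v (aeval x A.eraseLead) < v x ^ A.natDegree := by
    rcases Nat.eq_zero_or_pos A.natDegree with h0 | hpos
    · rw [eq_C_of_natDegree_eq_zero h0]; simp
    · refine (apply_aeval_le hv x (eraseLead_natDegree_le A)).trans_lt ?_
      rw [max_eq_right hx.le]
      exact pow_lt_pow_right₀ hx (by omega)
  rw [← hlead] at hlt ⊢
  rw [hv.add_eq_max_of_ne hlt.ne, max_eq_right hlt.le]

/-- For |x| > 1 the leading term of f dominates. For |x| ≤ 1 a Bézout relation prevents f(x) and
g(x) from both being small; no resultant constant is lost, because constants from the finite field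
have absolute value at most 1. -/
theorem AbsoluteValue.pow_le_max_apply_aeval (hv : IsNonarchimedean v) (x : K) {f g : k[X]}
    (hf : f ≠ 0) (hfg : IsCoprime f g) :
    max 1 (v x) ^ f.natDegree ≤ max (v (aeval x f)) (v (aeval x g)) := by
  rcases lt_or_ge 1 (v x) with hx | hx
  · rw [max_eq_right hx.le, ← apply_aeval_eq_pow hv hx hf]
    exact le_max_left _ _
  · rw [max_eq_left hx, one_pow]
    obtain ⟨a, b, hab⟩ := hfg
    have hle : ∀ q : k[X], v (aeval x q) ≤ 1 := fun q => by
      simpa [max_eq_left hx] using apply_aeval_le hv x (le_refl q.natDegree)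
    have h1 : aeval x a * aeval x f + aeval x b * aeval x g = 1 := by
      rw [← map_mul, ← map_mul, ← map_add, hab, map_one]
    calc (1 : ℝ) = v (aeval x a * aeval x f + aeval x b * aeval x g) := by rw [h1, map_one]
      _ ≤ max (v (aeval x a * aeval x f)) (v (aeval x b * aeval x g)) := hv _ _
      _ ≤ _ := by
        rw [map_mul, map_mul]
        exact max_le_max (mul_le_of_le_one_left (v.nonneg _) (hle a))
          (mul_le_of_le_one_left (v.nonneg _) (hle b))

theorem Real.log_max_one {t : ℝ} (ht : 0 < t) : Real.log (max 1 t) = max 0 (Real.log t) := by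
  rcases le_total 1 t with h | h
  · rw [max_eq_right h, max_eq_right (Real.log_nonneg h)]
  · rw [max_eq_left h, max_eq_left (Real.log_nonpos ht.le h), Real.log_one]

theorem Real.log_max_one_max {s t : ℝ} (hs : 0 < s) (ht : 0 < t) :
    Real.log (max 1 (max s t)) = max 0 (max (Real.log s) (Real.log t)) := by
  rw [Real.log_max_one (lt_max_of_lt_left hs)]
  congr 1
  rcases le_total s t with h | h
  · rw [max_eq_right h, max_eq_right (Real.log_le_log hs h)]
  · rw [max_eq_left h, max_eq_left (Real.log_le_log ht h)]

/-- The local form of the comparison of two solutions of `x + y = 1` through a linear form. -/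
theorem AbsoluteValue.log_add_le_of_linear_relation (hv : IsNonarchimedean v) {x y s t l A B C : K}
    {n N : ℕ} (hx : x ≠ 0) (hy : y ≠ 0) (hs : s ≠ 0) (ht : t ≠ 0) (hl0 : l ≠ 0)
    (hA : v A ≤ max 1 (max (v x) (v y)) ^ N) (hB : v B ≤ max 1 (max (v x) (v y)) ^ N)
    (hC : v C ≤ max 1 (max (v x) (v y)) ^ N) (hl : l = s / x ^ n * B - t / y ^ n * A)
    (hlx : l * x ^ n = B + t / y ^ n * C) (hly : l * y ^ n = -A - s / x ^ n * C) :
    Real.log (v l) + n * max 0 (max (Real.log (v x)) (Real.log (v y))) ≤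
      max 0 (max (Real.log (v s) - n * Real.log (v x)) (Real.log (v t) - n * Real.log (v y))) +
        N * max 0 (max (Real.log (v x)) (Real.log (v y))) := by
  have px := v.pos hx
  have py := v.pos hy
  have ps := v.pos hs
  have pt := v.pos ht
  have pl := v.pos hl0
  set m := max 1 (max (v x) (v y)) with hm
  have hm1 : 1 ≤ m := le_max_left _ _
  set D := max 1 (max (v (s / x ^ n)) (v (t / y ^ n))) with hD
  have hD1 : 1 ≤ D := le_max_left _ _
  have hDs : v (s / x ^ n) ≤ D := (le_max_left _ _).trans (le_max_right _ _)
  have hDt : v (t / y ^ n) ≤ D := (le_max_right _ _).trans (le_max_right _ _)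
  have hmul : ∀ {a b : K}, v a ≤ D → v b ≤ m ^ N → v (a * b) ≤ D * m ^ N := fun ha hb => by
    rw [map_mul]; exact mul_le_mul ha hb (v.nonneg _) (by positivity)
  have hone : ∀ {b : K}, v b ≤ m ^ N → v b ≤ D * m ^ N := fun hb =>
    hb.trans (le_mul_of_one_le_left (by positivity) hD1)
  have hsub : ∀ {a b : K} {c : ℝ}, v a ≤ c → v b ≤ c → v (a - b) ≤ c := fun {a b c} ha hb => by
    rw [sub_eq_add_neg]
    exact (hv _ _).trans (max_le ha (by rwa [v.map_neg]))
  -- Each of the three expressions for l serves the case where the corresponding one of 1, |y|, |x|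
  -- is the maximum m.
  have key : v l * m ^ n ≤ D * m ^ N := by
    rcases le_total (max (v x) (v y)) 1 with h | h
    · have hmo : m = 1 := by rw [hm, max_eq_left h]
      calc v l * m ^ n = v l := by rw [hmo, one_pow, mul_one]
        _ ≤ D * m ^ N := by rw [hl]; exact hsub (hmul hDs hB) (hmul hDt hA)
    · rcases le_total (v x) (v y) with hxy | hxy
      · have hmy : m = v y := by rw [hm, max_eq_right h, max_eq_right hxy]
        nth_rewrite 1 [hmy]
        rw [← map_pow, ← map_mul, hly]
        exact hsub (hone ((v.map_neg A).trans_le hA)) (hmul hDs hC)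
      · have hmx : m = v x := by rw [hm, max_eq_right h, max_eq_left hxy]
        nth_rewrite 1 [hmx]
        rw [← map_pow, ← map_mul, hlx]
        exact (hv _ _).trans (max_le (hone hB) (hmul hDt hC))
  have hlog := Real.log_le_log (by positivity) key
  rw [Real.log_mul pl.ne' (by positivity), Real.log_mul (by positivity) (by positivity),
    Real.log_pow, Real.log_pow, hm, Real.log_max_one_max px py, hD,
    Real.log_max_one_max (v.pos (div_ne_zero hs (pow_ne_zero n hx)))
      (v.pos (div_ne_zero ht (pow_ne_zero n hy)))] at hlog
  simp only [map_div₀, map_pow] at hlog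
  rwa [Real.log_div ps.ne' (by positivity), Real.log_div pt.ne' (by positivity), Real.log_pow,
    Real.log_pow] at hlog

/-- If `s` is a rational function of `x` given by coprime polynomials, its local height is at
least the degree times the local height of `x`. -/
theorem AbsoluteValue.natDegree_mul_log_le (hv : IsNonarchimedean v) {x y s t : K} {f g : k[X]}
    (hx : x ≠ 0) (hy : y ≠ 0) (hxy : x + y = 1) (hs : s ≠ 0) (ht : t ≠ 0) (hf : f ≠ 0)
    (hfg : IsCoprime f g) (hg : aeval x g ≠ 0) (h : aeval x g * s = -aeval x f) :
    f.natDegree * max 0 (max (Real.log (v x)) (Real.log (v y))) ≤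
      Real.log (v (aeval x g)) + max 0 (max (Real.log (v s)) (Real.log (v t))) := by
  have px := v.pos hx
  have py := v.pos hy
  have ps := v.pos hs
  have pt := v.pos ht
  have pg := v.pos hg
  have hmax : max 1 (max (v x) (v y)) = max 1 (v x) := by
    refine le_antisymm (max_le (le_max_left _ _) (max_le (le_max_right _ _) ?_))
      (max_le_max le_rfl (le_max_left _ _))
    rw [show y = 1 + -x by rw [← hxy]; ring]
    refine (hv _ _).trans ?_
    rw [map_one, v.map_neg]
  have key : max 1 (max (v x) (v y)) ^ f.natDegree ≤
      v (aeval x g) * max 1 (max (v s) (v t)) := by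
    rw [hmax]
    refine (pow_le_max_apply_aeval hv x hf hfg).trans (max_le ?_ ?_)
    · rw [← v.map_neg (aeval x f), ← h, map_mul]
      exact mul_le_mul_of_nonneg_left ((le_max_left _ _).trans (le_max_right _ _)) pg.le
    · exact le_mul_of_one_le_right pg.le (le_max_left _ _)
  have hlog := Real.log_le_log (by positivity) key
  rwa [Real.log_pow, Real.log_mul pg.ne' (by positivity), Real.log_max_one_max px py,
    Real.log_max_one_max ps pt] at hlog

end

/-! ### Product formula and global height inequalities -/

/-- A family of nonarchimedean absolute values on `K` that satisfies the product formula on the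
subfield `L` and detects the elements of finite order of `L`. -/
structure IsProperFamily {K M : Type*} [Field K] (v : M → AbsoluteValue K ℝ) (L : Subfield K) :
    Prop where
  isNonarchimedean (i : M) : IsNonarchimedean (v i)
  finite {x : K} (hx : x ∈ L) (h0 : x ≠ 0) : {i | v i x ≠ 1}.Finite
  finsum_log {x : K} (hx : x ∈ L) (h0 : x ≠ 0) : ∑ᶠ i, Real.log (v i x) = 0
  exists_pow_eq_one {x : K} (hx : x ∈ L) (h0 : x ≠ 0) (h : ∀ i, v i x ≤ 1) :
    ∃ n : ℕ, 0 < n ∧ x ^ n = 1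

namespace IsProperFamily

variable {K M : Type*} [Field K] {v : M → AbsoluteValue K ℝ} {L : Subfield K}

theorem exists_sum_log_eq_zero (hv : IsProperFamily v L) (S : Finset M) {z : K} (hz : z ∈ L)
    (h0 : z ≠ 0) :
    ∃ T : Finset M, Disjoint S T ∧ ∑ i ∈ S, Real.log (v i z) + ∑ i ∈ T, Real.log (v i z) = 0 := by
  classical
  let F := (hv.finite hz h0).toFinset
  refine ⟨F \ S, Finset.disjoint_sdiff, ?_⟩
  rw [← Finset.sum_union Finset.disjoint_sdiff, Finset.union_sdiff_self_eq_union,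
    ← hv.finsum_log hz h0]
  symm
  refine finsum_eq_sum_of_support_subset _ fun i hi => ?_
  rw [Finset.coe_union]
  refine Or.inr ?_
  simp only [F, Set.Finite.coe_toFinset, Set.mem_ofPred_eq]
  intro h1
  exact hi (by simp [h1])

theorem sum_log_nonneg (hv : IsProperFamily v L) (S : Finset M) {z : K} (hz : z ∈ L)
    (h0 : z ≠ 0) (h : ∀ i ∉ S, Real.log (v i z) ≤ 0) : 0 ≤ ∑ i ∈ S, Real.log (v i z) := by
  obtain ⟨T, hd, hT⟩ := hv.exists_sum_log_eq_zero S hz h0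
  have := Finset.sum_nonpos fun i hi => h i (Finset.disjoint_right.1 hd hi)
  linarith

theorem sum_log_nonpos (hv : IsProperFamily v L) (S : Finset M) {z : K} (hz : z ∈ L)
    (h0 : z ≠ 0) (h : ∀ i ∉ S, 0 ≤ Real.log (v i z)) : ∑ i ∈ S, Real.log (v i z) ≤ 0 := by
  obtain ⟨T, hd, hT⟩ := hv.exists_sum_log_eq_zero S hz h0
  have := Finset.sum_nonneg fun i hi => h i (Finset.disjoint_right.1 hd hi)
  linarith

theorem sum_log_eq_zero (hv : IsProperFamily v L) (S : Finset M) {z : K} (hz : z ∈ L)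
    (h0 : z ≠ 0) (h : ∀ i ∉ S, v i z = 1) : ∑ i ∈ S, Real.log (v i z) = 0 :=
  le_antisymm (hv.sum_log_nonpos S hz h0 fun i hi => by simp [h i hi])
    (hv.sum_log_nonneg S hz h0 fun i hi => by simp [h i hi])

end IsProperFamily

/-- The height of the point `(0 : a : b)` given by logarithms at finitely many places. -/
noncomputable def logHt {M : Type*} (S : Finset M) (a b : M → ℝ) : ℝ :=
  ∑ i ∈ S, max 0 (max (a i) (b i))

section

open Polynomial

theorem Subfield.aeval_mem {k K : Type*} [Field k] [Field K] [Algebra k K] {L : Subfield K}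
    (hk : ∀ c : k, algebraMap k K c ∈ L) {x : K}
    (hx : x ∈ L) (P : k[X]) : aeval x P ∈ L := by
  rw [aeval_eq_sum_range]
  refine sum_mem fun i _ => ?_
  rw [Algebra.smul_def]
  exact mul_mem (hk _) (pow_mem hx i)

variable {k K M : Type*} [Field k] [Finite k] [Field K] [Algebra k K] {v : M → AbsoluteValue K ℝ}
  {L : Subfield K}

/-- The alternative is whether the linear form l vanishes. If not, l has absolute value at most 1
outside `S`, so the sum of its logarithms over `S` is nonnegative and the local bounds add up. If it
does, the relations among A(x), B(x), C(x) express s through x. -/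
theorem IsProperFamily.pade_dichotomy (hv : IsProperFamily v L)
    (hk : ∀ c : k, algebraMap k K c ∈ L) (S : Finset M) {x y s t : K}
    (hxL : x ∈ L) (hyL : y ∈ L) (hsL : s ∈ L) (htL : t ∈ L)
    (hx : x ≠ 0) (hy : y ≠ 0) (hs : s ≠ 0) (ht : t ≠ 0) (hxy : x + y = 1) (hst : s + t = 1)
    (hxS : ∀ i ∉ S, v i x = 1) (hyS : ∀ i ∉ S, v i y = 1)
    (hsS : ∀ i ∉ S, v i s = 1) (htS : ∀ i ∉ S, v i t = 1)
    {n N : ℕ} {A B C : k[X]} (hA : A.natDegree ≤ N) (hB : B.natDegree ≤ N) (hC : C.natDegree ≤ N)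
    (hrel : X ^ n * A + (1 - X) ^ n * B + C = 0) :
    (n - N) * logHt S (fun i => Real.log (v i x)) (fun i => Real.log (v i y)) ≤
      logHt S (fun i => Real.log (v i s) - n * Real.log (v i x))
        (fun i => Real.log (v i t) - n * Real.log (v i y)) ∨
    aeval x C * s = -aeval x (X ^ n * A) := by
  have hrel' : x ^ n * aeval x A + y ^ n * aeval x B + aeval x C = 0 := by
    have := congrArg (aeval x) hrel
    simpa [show (1 : K) - x = y by rw [← hxy]; ring] using this
  have hxn := pow_ne_zero n hx
  have hyn := pow_ne_zero n hy
  set l : K := s / x ^ n * aeval x B - t / y ^ n * aeval x A with hl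
  have hlx : l * x ^ n = aeval x B + t / y ^ n * aeval x C := by
    rw [hl]; field_simp
    linear_combination (-t) * hrel' + y ^ n * aeval x B * hst
  have hly : l * y ^ n = -aeval x A - s / x ^ n * aeval x C := by
    rw [hl]; field_simp
    linear_combination s * hrel' - x ^ n * aeval x A * hst
  by_cases hl0 : l = 0
  · right
    rw [hl0, zero_mul] at hly
    rw [map_mul, map_pow, aeval_X]
    field_simp at hly
    linear_combination hly
  · left
    have hbd : ∀ {P : k[X]}, P.natDegree ≤ N → ∀ i,
        v i (aeval x P) ≤ max 1 (max (v i x) (v i y)) ^ N := fun {P} hP i => by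
      refine (AbsoluteValue.apply_aeval_le (hv.isNonarchimedean i) x hP).trans ?_
      gcongr
      exact le_max_left _ _
    have hlL : l ∈ L := sub_mem
      (mul_mem (div_mem hsL (pow_mem hxL n)) (Subfield.aeval_mem hk hxL B))
      (mul_mem (div_mem htL (pow_mem hyL n)) (Subfield.aeval_mem hk hxL A))
    have hloc := fun i => AbsoluteValue.log_add_le_of_linear_relation (hv.isNonarchimedean i)
      hx hy hs ht hl0 (hbd hA i) (hbd hB i) (hbd hC i) hl hlx hly
    have hout : ∀ i ∉ S, Real.log (v i l) ≤ 0 := fun i hi => by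
      have := hloc i
      simpa [hxS i hi, hyS i hi, hsS i hi, htS i hi] using this
    have h0 := hv.sum_log_nonneg S hlL hl0 hout
    have hsum := Finset.sum_le_sum fun i (_ : i ∈ S) => hloc i
    rw [Finset.sum_add_distrib, Finset.sum_add_distrib, ← Finset.mul_sum, ← Finset.mul_sum] at hsum
    simp only [logHt]
    linarith

/-- The denominator g(x) need not be an `S`-unit, but the local bounds force its logarithm to be
nonnegative outside `S`, so by the product formula it contributes at most 0 over `S`. -/
theorem IsProperFamily.natDegree_mul_logHt_le (hv : IsProperFamily v L)
    (hk : ∀ c : k, algebraMap k K c ∈ L) (S : Finset M) {x y s t : K} (hxL : x ∈ L)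
    (hx : x ≠ 0) (hy : y ≠ 0) (hs : s ≠ 0) (ht : t ≠ 0) (hxy : x + y = 1)
    (hxS : ∀ i ∉ S, v i x = 1) (hyS : ∀ i ∉ S, v i y = 1)
    (hsS : ∀ i ∉ S, v i s = 1) (htS : ∀ i ∉ S, v i t = 1)
    {f g : k[X]} (hf : f ≠ 0) (hfg : IsCoprime f g) (h : aeval x g * s = -aeval x f) :
    f.natDegree * logHt S (fun i => Real.log (v i x)) (fun i => Real.log (v i y)) ≤
      logHt S (fun i => Real.log (v i s)) (fun i => Real.log (v i t)) := by
  have hg : aeval x g ≠ 0 := by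
    intro h0
    obtain ⟨a, b, hab⟩ := hfg
    have h1 := congrArg (aeval x) hab
    rw [h0, zero_mul, zero_eq_neg] at h
    simp [h0, h] at h1
  have hloc := fun i => AbsoluteValue.natDegree_mul_log_le (hv.isNonarchimedean i)
    hx hy hxy hs ht hf hfg hg h
  have hout : ∀ i ∉ S, 0 ≤ Real.log (v i (aeval x g)) := fun i hi => by
    have := hloc i
    simpa [hxS i hi, hyS i hi, hsS i hi, htS i hi] using this
  have h0 := hv.sum_log_nonpos S (Subfield.aeval_mem hk hxL g) hg hout
  have hsum := Finset.sum_le_sum fun i (_ : i ∈ S) => hloc i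
  rw [Finset.sum_add_distrib, ← Finset.mul_sum] at hsum
  simp only [logHt]
  linarith

end

/-! ### The height as a sublinear function on logarithmic vectors -/

section logHt

variable {M : Type*} (S : Finset M)

theorem logHt_nonneg (a b : M → ℝ) : 0 ≤ logHt S a b :=
  Finset.sum_nonneg fun _ _ => le_max_left _ _

theorem logHt_smul {c : ℝ} (hc : 0 ≤ c) (a b : M → ℝ) :
    logHt S (c • a) (c • b) = c * logHt S a b := by
  simp only [logHt, Pi.smul_apply, smul_eq_mul, Finset.mul_sum]
  refine Finset.sum_congr rfl fun i _ => ?_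
  rw [← mul_max_of_nonneg _ _ hc]
  nth_rewrite 1 [← mul_zero c]
  rw [← mul_max_of_nonneg _ _ hc]

theorem logHt_add_le (a b a' b' : M → ℝ) :
    logHt S (a + a') (b + b') ≤ logHt S a b + logHt S a' b' := by
  simp only [logHt, Pi.add_apply, ← Finset.sum_add_distrib]
  refine Finset.sum_le_sum fun i _ => ?_
  grind

theorem logHt_neg_le {a b : M → ℝ} (ha : ∑ i ∈ S, a i = 0) (hb : ∑ i ∈ S, b i = 0) :
    logHt S (-a) (-b) ≤ 2 * logHt S a b := by
  have : logHt S (-a) (-b) ≤ ∑ i ∈ S, (2 * max 0 (max (a i) (b i)) - a i - b i) := by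
    refine Finset.sum_le_sum fun i _ => ?_
    simp only [Pi.neg_apply]
    grind
  rw [Finset.sum_sub_distrib, Finset.sum_sub_distrib, ha, hb, ← Finset.mul_sum] at this
  simpa [logHt] using this

/-- Subtracting (a + b)/3 changes no sum and centres 0, a, b. Each then becomes a third of a sum of
two terms among ±a, ±b, ±(a - b), whence the factor 2/3. -/
theorem logHt_le_of_sum_eq_zero {a b : M → ℝ} (ha : ∑ i ∈ S, a i = 0) (hb : ∑ i ∈ S, b i = 0) :
    logHt S a b ≤ 2 / 3 * ∑ i ∈ S, max |a i| (max |b i| |a i - b i|) := by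
  have : logHt S a b ≤
      ∑ i ∈ S, (2 / 3 * max |a i| (max |b i| |a i - b i|) + 1 / 3 * a i + 1 / 3 * b i) := by
    refine Finset.sum_le_sum fun i _ => ?_
    have h1 := le_max_left |a i| (max |b i| |a i - b i|)
    have h2 : |b i| ≤ max |a i| (max |b i| |a i - b i|) := by simp
    have h3 : |a i - b i| ≤ max |a i| (max |b i| |a i - b i|) := by simp
    rw [abs_le] at h1 h2 h3
    refine max_le ?_ (max_le ?_ ?_) <;> linarith
  rw [Finset.sum_add_distrib, Finset.sum_add_distrib, ← Finset.mul_sum, ← Finset.mul_sum,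
    ← Finset.mul_sum, ha, hb] at this
  linarith

theorem sum_max_abs_le {a b : M → ℝ} (ha : ∑ i ∈ S, a i = 0) (hb : ∑ i ∈ S, b i = 0) :
    ∑ i ∈ S, max |a i| (max |b i| |a i - b i|) ≤ 3 * logHt S a b := by
  have : ∑ i ∈ S, max |a i| (max |b i| |a i - b i|) ≤
      ∑ i ∈ S, (3 * max 0 (max (a i) (b i)) - a i - b i) := by
    refine Finset.sum_le_sum fun i _ => ?_
    have h0 := le_max_left 0 (max (a i) (b i))
    have h1 : a i ≤ max 0 (max (a i) (b i)) := by simp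
    have h2 : b i ≤ max 0 (max (a i) (b i)) := by simp
    refine max_le ?_ (max_le ?_ ?_) <;> rw [abs_le] <;> constructor <;> linarith
  rw [Finset.sum_sub_distrib, Finset.sum_sub_distrib, ha, hb, ← Finset.mul_sum] at this
  simpa [logHt] using this

/-- Split the difference into a multiple of the small vector u₂ - u₁ and a multiple of u₂ or of -u₁.
The factor 2 in the second case is the asymmetry of the height under negation. -/
theorem logHt_sub_smul_le {a₁ b₁ a₂ b₂ : M → ℝ} {h c ε : ℝ} (hh : 0 ≤ h) (hc : 0 ≤ c)
    (ha₁ : ∑ i ∈ S, a₁ i = 0) (hb₁ : ∑ i ∈ S, b₁ i = 0)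
    (h₁ : logHt S a₁ b₁ = 1) (h₂ : logHt S a₂ b₂ = 1)
    (hε : logHt S (a₂ - a₁) (b₂ - b₁) ≤ ε) :
    (c ≤ h → logHt S (h • a₂ - c • a₁) (h • b₂ - c • b₁) ≤ h - c + c * ε) ∧
      (h ≤ c → logHt S (h • a₂ - c • a₁) (h • b₂ - c • b₁) ≤ 2 * (c - h) + h * ε) := by
  constructor
  · intro hch
    have e : ∀ u w : M → ℝ, h • u - c • w = (h - c) • u + c • (u - w) := fun u w => by module
    rw [e, e]
    refine (logHt_add_le S _ _ _ _).trans ?_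
    rw [logHt_smul S (sub_nonneg.2 hch), logHt_smul S hc, h₂, mul_one]
    gcongr
  · intro hhc
    have e : ∀ u w : M → ℝ, h • u - c • w = (c - h) • (-w) + h • (u - w) := fun u w => by module
    rw [e, e]
    refine (logHt_add_le S _ _ _ _).trans ?_
    rw [logHt_smul S (sub_nonneg.2 hhc), logHt_smul S hh]
    have := logHt_neg_le S ha₁ hb₁
    rw [h₁, mul_one] at this
    rw [mul_comm 2]
    gcongr

end logHt

/-! ### Numerical form of the gap principle -/

/-- The numerical heart of the gap principle: the ratio of the heights of two solutions pointing
in nearly the same direction is close to twice a power of `p`. -/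
theorem exists_pow_mul_le_of_gap {p : ℕ} (hp : 1 < p) {h₁ h₂ : ℝ} (h₁pos : 0 < h₁) (h₁₂ : h₁ ≤ h₂)
    (X : ℝ → ℝ) (hX₁ : ∀ c, 0 ≤ c → c ≤ h₂ → X c ≤ h₂ - c + c * (2 / 9))
    (hX₂ : ∀ c, h₂ ≤ c → X c ≤ 2 * (c - h₂) + h₂ * (2 / 9))
    (hgap₀ : ∀ k : ℕ, p ^ k * h₁ ≤ X (p ^ k * h₁))
    (hgap : ∀ k N : ℕ, 3 * N + 1 < p → (N + 1) * (p ^ k * h₁) ≤ X ((2 * N + 1) * (p ^ k * h₁)) ∨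
      (3 * N + 1) * (p ^ k * h₁) ≤ h₂) :
    3 < p ∧ ∃ k : ℕ, 16 / 9 * p ^ k * h₁ ≤ h₂ ∧ h₂ ≤ 9 / 4 * p ^ k * h₁ := by
  have hp' : (1 : ℝ) < p := by exact_mod_cast hp
  obtain ⟨k, hk₁, hk₂⟩ := exists_nat_pow_near ((one_le_div h₁pos).2 h₁₂) hp'
  rw [le_div_iff₀ h₁pos] at hk₁
  rw [div_lt_iff₀ h₁pos, pow_succ] at hk₂
  have g0 := hgap₀ k
  have g1 := hgap₀ (k + 1)
  have hgapk := hgap k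
  have hW : 0 < (p : ℝ) ^ k * h₁ := by positivity
  rw [pow_succ] at g1
  have e1 : (p : ℝ) ^ k * p * h₁ = p * (p ^ k * h₁) := by ring
  rw [e1] at g1 hk₂
  set W : ℝ := p ^ k * h₁ with hWdef
  have r0 := hX₁ W hW.le hk₁
  have r1 := hX₂ _ hk₂.le
  -- The elementary gap at the two neighbouring Frobenius powers W ≤ h₂ < pW already excludes ratios
  -- near 1 and near p.
  have low : 16 / 9 * W ≤ h₂ := by linarith
  have high : 16 / 9 * h₂ ≤ p * W := by linarith
  have hp4 : 3 < p := by
    have : (256 / 81 : ℝ) * W ≤ p * W := by linarith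
    have := le_of_mul_le_mul_right this hW
    have : (3 : ℝ) < p := by linarith
    exact_mod_cast this
  refine ⟨hp4, k, by rw [mul_assoc]; exact low, ?_⟩
  rw [mul_assoc, ← hWdef]
  by_contra! hlarge
  obtain ⟨s, hs⟩ : ∃ s, h₂ = s * W := ⟨h₂ / W, by field_simp⟩
  rw [hs] at hlarge high
  have hs1 : 9 / 4 < s := lt_of_mul_lt_mul_right hlarge hW.le
  have hs2 : 16 / 9 * s ≤ p := by
    rw [← mul_assoc] at high
    exact le_of_mul_le_mul_right high hW
  -- The least N with s ≤ (27N + 36)/16. Then 16s/9 > 3N + 1, which refutes the case (2N+1)W ≥ h₂,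
  -- while 3N + 1 < 16s/9 + 1 is not quite enough for p; the ceiling bound gives precisely 3N + 1 <
  -- 16s/9 ≤ p.
  set N := ⌈(16 * s - 36) / 27⌉₊ with hN
  have hN1 : 0 < N := Nat.ceil_pos.2 (by linarith)
  have hN1' : (1 : ℝ) ≤ N := by exact_mod_cast hN1
  have hN2 : (16 * s - 36) / 27 ≤ N := Nat.le_ceil _
  have hN3 : (N : ℝ) < (16 * s - 36) / 27 + 1 := Nat.ceil_lt_add_one (by linarith)
  have hNp : 3 * N + 1 < p := by
    have : (3 * N + 1 : ℝ) < p := by linarith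
    exact_mod_cast this
  rcases hgapk N hNp with h | h
  · rcases le_total ((2 * N + 1) * W) h₂ with hc | hc
    · have := hX₁ _ (by positivity) hc
      have h3 : (N + 1 : ℝ) * W ≤ (s - (2 * N + 1) + (2 * N + 1) * (2 / 9)) * W := by
        linarith
      have := le_of_mul_le_mul_right h3 hW
      linarith
    · have := hX₂ _ hc
      have h3 : (N + 1 : ℝ) * W ≤ (2 * (2 * N + 1 - s) + s * (2 / 9)) * W := by
        linarith
      have := le_of_mul_le_mul_right h3 hW
      linarith
  · rw [hs] at h
    have := le_of_mul_le_mul_right h hW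
    linarith

/-- Composing the first two ratios puts h₃/h₁ in [256/81, 81/16]·p^(i+j). This lies above
9/4·p^(i+j) and, as p > 3, below 16/9·p^(i+j+1), so it misses every admissible interval. -/
theorem not_three_ratios {p : ℕ} (hp : 3 < p) {h₁ h₂ h₃ : ℝ} (h₁pos : 0 < h₁)
    (h₁₂ : ∃ k : ℕ, 16 / 9 * p ^ k * h₁ ≤ h₂ ∧ h₂ ≤ 9 / 4 * p ^ k * h₁)
    (h₂₃ : ∃ k : ℕ, 16 / 9 * p ^ k * h₂ ≤ h₃ ∧ h₃ ≤ 9 / 4 * p ^ k * h₂)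
    (h₁₃ : ∃ k : ℕ, 16 / 9 * p ^ k * h₁ ≤ h₃ ∧ h₃ ≤ 9 / 4 * p ^ k * h₁) : False := by
  obtain ⟨i, hi₁, hi₂⟩ := h₁₂
  obtain ⟨j, hj₁, hj₂⟩ := h₂₃
  obtain ⟨m, hm₁, hm₂⟩ := h₁₃
  have hp' : (3 : ℝ) < p := by exact_mod_cast hp
  have hQ : (0 : ℝ) < p ^ (i + j) * h₁ := by positivity
  have l1 : 256 / 81 * (p ^ (i + j) * h₁) ≤ h₃ := by
    calc 256 / 81 * (p ^ (i + j) * h₁) = 16 / 9 * p ^ j * (16 / 9 * p ^ i * h₁) := by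
          rw [pow_add]; ring
      _ ≤ 16 / 9 * p ^ j * h₂ := by gcongr
      _ ≤ h₃ := hj₁
  have l2 : h₃ ≤ 81 / 16 * (p ^ (i + j) * h₁) := by
    calc h₃ ≤ 9 / 4 * p ^ j * h₂ := hj₂
      _ ≤ 9 / 4 * p ^ j * (9 / 4 * p ^ i * h₁) := by gcongr
      _ = 81 / 16 * (p ^ (i + j) * h₁) := by rw [pow_add]; ring
  rcases Nat.lt_or_ge (i + j) m with h | h
  · obtain ⟨d, rfl⟩ := Nat.exists_eq_add_of_lt h
    have : (p : ℝ) ≤ p ^ (d + 1) := le_self_pow₀ (by linarith) (by omega)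
    have h3 : 16 / 9 * (3 * (p ^ (i + j) * h₁)) ≤ h₃ := by
      calc 16 / 9 * (3 * (p ^ (i + j) * h₁)) ≤ 16 / 9 * (p ^ (d + 1) * (p ^ (i + j) * h₁)) := by
            gcongr; linarith
        _ = 16 / 9 * p ^ (i + j + d + 1) * h₁ := by ring
        _ ≤ h₃ := hm₁
    linarith
  · have : (p : ℝ) ^ m ≤ p ^ (i + j) := pow_le_pow_right₀ (by linarith) h
    have h3 : h₃ ≤ 9 / 4 * (p ^ (i + j) * h₁) := by
      calc h₃ ≤ 9 / 4 * p ^ m * h₁ := hm₂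
        _ ≤ 9 / 4 * p ^ (i + j) * h₁ := by gcongr
        _ = _ := by ring
    linarith

/-! ### Places of a rational function field -/

section FractionField

open scoped NNReal

variable {R F : Type*} [CommRing R] [IsDomain R] [Field F] [Algebra R F] [IsFractionRing R F]

theorem exists_absoluteValue_algebraMap_eq (w : R → ℝ≥0) (w1 : w 1 = 1) (w0 : ∀ f, w f = 0 ↔ f = 0)
    (wmul : ∀ f g, w (f * g) = w f * w g) (wadd : ∀ f g, w (f + g) ≤ max (w f) (w g)) :
    ∃ v : AbsoluteValue F ℝ, IsNonarchimedean v ∧ ∀ f : R, v (algebraMap R F f) = w f := by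
  let W : Valuation R ℝ≥0 :=
    { toFun := w
      map_zero' := (w0 0).2 rfl
      map_one' := w1
      map_mul' := wmul
      map_add_le_max' := wadd }
  have hS : nonZeroDivisors R ≤ W.supp.primeCompl := fun f hf h =>
    nonZeroDivisors.ne_zero hf ((w0 f).1 h)
  let V : Valuation F ℝ≥0 := W.extendToLocalization hS F
  refine ⟨{ toFun := fun x => V x
            map_mul' := fun x y => by simp
            nonneg' := fun x => NNReal.coe_nonneg _
            eq_zero' := fun x => by simp
            add_le' := fun x y => ?_ }, fun x y => ?_, fun f => ?_⟩
  · have h := V.map_add x y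
    have h2 : max (V x) (V y) ≤ V x + V y := max_le (by simp) (by simp)
    exact_mod_cast h.trans h2
  · have h := V.map_add x y
    show (V (x + y) : ℝ) ≤ max (V x : ℝ) (V y : ℝ)
    exact_mod_cast h
  · show (V (algebraMap R F f) : ℝ) = w f
    rw [Valuation.extendToLocalization_apply_map_apply]
    rfl

theorem exists_absoluteValue_multiplicity [UniqueFactorizationMonoid R] {q : R} (hq : Prime q)
    {c : ℝ} (hc : 0 < c) (hc1 : c ≤ 1) :
    ∃ v : AbsoluteValue F ℝ, IsNonarchimedean v ∧
      ∀ f : R, f ≠ 0 → v (algebraMap R F f) = c ^ multiplicity q f := by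
  classical
  lift c to ℝ≥0 using hc.le
  have hc : 0 < c := by exact_mod_cast hc
  have hc1 : c ≤ 1 := by exact_mod_cast hc1
  refine Exists.elim (exists_absoluteValue_algebraMap_eq (F := F)
    (fun f : R => if f = 0 then 0 else c ^ multiplicity q f)
    ?_ ?_ ?_ ?_) fun v hv => ⟨v, hv.1, fun f hf => ?_⟩
  · simp [multiplicity_eq_zero.2 (fun h => hq.not_isUnit (isUnit_of_dvd_one h))]
  · intro f
    by_cases hf : f = 0
    · simp [hf]
    · simp [hf, hc.ne']
  · intro f g
    by_cases hf : f = 0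
    · simp [hf]
    by_cases hg : g = 0
    · simp [hg]
    simp only [hf, hg, mul_eq_zero, or_self, if_false]
    rw [multiplicity_mul hq (FiniteMultiplicity.of_prime_left hq (mul_ne_zero hf hg)), pow_add]
  · intro f g
    by_cases hf : f = 0
    · simp [hf]
    by_cases hg : g = 0
    · simp [hg]
    by_cases hfg : f + g = 0
    · simp [hfg]
    simp only [hf, hg, hfg, if_false]
    have key : min (multiplicity q f) (multiplicity q g) ≤ multiplicity q (f + g) :=
      (FiniteMultiplicity.of_prime_left hq hfg).le_multiplicity_of_pow_dvd
        (dvd_add ((pow_dvd_pow q (min_le_left _ _)).trans (pow_multiplicity_dvd q f))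
          ((pow_dvd_pow q (min_le_right _ _)).trans (pow_multiplicity_dvd q g)))
    refine (pow_le_pow_of_le_one hc.le hc1 key).trans ?_
    rcases min_choice (multiplicity q f) (multiplicity q g) with h | h <;> rw [h] <;> simp
  · rw [hv.2, if_neg hf]
    simp

theorem exists_absoluteValue_totalDegree {B k F : Type*} [Field k] [Field F]
    [Algebra (MvPolynomial B k) F] [IsFractionRing (MvPolynomial B k) F] :
    ∃ v : AbsoluteValue F ℝ, IsNonarchimedean v ∧ ∀ f : MvPolynomial B k, f ≠ 0 →
      v (algebraMap _ F f) = Real.exp f.totalDegree := by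
  classical
  refine Exists.elim (exists_absoluteValue_algebraMap_eq (F := F)
    (fun f : MvPolynomial B k => if f = 0 then (0 : ℝ≥0) else (Real.exp 1).toNNReal ^ f.totalDegree)
    ?_ ?_ ?_ ?_) fun v hv => ⟨v, hv.1, fun f hf => ?_⟩
  · simp
  · intro f
    by_cases hf : f = 0
    · simp [hf]
    · simp [hf, Real.exp_pos]
  · intro f g
    by_cases hf : f = 0
    · simp [hf]
    by_cases hg : g = 0
    · simp [hg]
    simp only [hf, hg, mul_eq_zero, or_self, if_false]
    rw [MvPolynomial.totalDegree_mul_of_isDomain hf hg, pow_add]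
  · intro f g
    by_cases hf : f = 0
    · simp [hf]
    by_cases hg : g = 0
    · simp [hg]
    by_cases hfg : f + g = 0
    · simp [hfg]
    simp only [hf, hg, hfg, if_false]
    have h1 : (1 : ℝ≥0) ≤ (Real.exp 1).toNNReal := by
      rw [Real.one_le_toNNReal]; exact Real.one_le_exp zero_le_one
    refine (pow_le_pow_right₀ h1 (MvPolynomial.totalDegree_add f g)).trans ?_
    rcases max_choice f.totalDegree g.totalDegree with h | h <;> rw [h] <;> simp
  · rw [hv.2, if_neg hf]
    simp [← Real.exp_nat_mul, (Real.exp_pos 1).le]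

end FractionField

/-- The product formula for a single element. -/
def HasProductFormula {K M : Type*} [Field K] (v : M → AbsoluteValue K ℝ) (x : K) : Prop :=
  {i | v i x ≠ 1}.Finite ∧ ∑ᶠ i, Real.log (v i x) = 0

namespace HasProductFormula

variable {K M : Type*} [Field K] {v : M → AbsoluteValue K ℝ} {x y : K}

theorem hasFiniteSupport (hx : {i | v i x ≠ 1}.Finite) :
    Function.HasFiniteSupport fun i => Real.log (v i x) :=
  hx.subset fun i hi h1 => hi (by simp [h1])

theorem mul (hx : HasProductFormula v x) (hy : HasProductFormula v y) (hx0 : x ≠ 0)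
    (hy0 : y ≠ 0) : HasProductFormula v (x * y) := by
  refine ⟨(hx.1.union hy.1).subset fun i hi => ?_, ?_⟩
  · by_contra h
    simp only [Set.mem_union, Set.mem_ofPred_eq, not_or, not_not] at h
    exact hi (by rw [map_mul, h.1, h.2, one_mul])
  · simp only [map_mul]
    simp_rw [fun i => Real.log_mul ((v i).ne_zero hx0) ((v i).ne_zero hy0)]
    rw [finsum_add_distrib (hasFiniteSupport hx.1) (hasFiniteSupport hy.1), hx.2, hy.2, add_zero]

theorem inv (hx : HasProductFormula v x) : HasProductFormula v x⁻¹ := by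
  refine ⟨by simpa using hx.1, ?_⟩
  simp only [map_inv₀, Real.log_inv]
  rw [finsum_neg_distrib, hx.2, neg_zero]

end HasProductFormula

universe uB uk in
-- The places are the irreducible polynomials q, weighted by total degree, and the total degree
-- itself; on a prime the two contributions ±deg q cancel, and unique factorization gives the rest.
-- An element bounded by 1 everywhere has a unit denominator and a numerator of degree 0.
theorem exists_product_formula_fractionField (B : Type uB) (k : Type uk) (F : Type*) [Field k] [Field F]
    [Algebra (MvPolynomial B k) F] [IsFractionRing (MvPolynomial B k) F] :
    ∃ (I : Type (max uk uB)) (v : I → AbsoluteValue F ℝ), (∀ i, IsNonarchimedean (v i)) ∧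
      (∀ x : F, x ≠ 0 → HasProductFormula v x) ∧
      ∀ x : F, (∀ i, v i x ≤ 1) → ∃ c : k, x = algebraMap (MvPolynomial B k) F (MvPolynomial.C c) := by
  classical
  let R := MvPolynomial B k
  let Q := {P : Associates R // Irreducible P}
  have hQ : ∀ P : Q, Prime (Quot.out P.1) := fun P =>
    ((Associates.irreducible_mk.1 (by rw [Associates.quot_out]; exact P.2))).prime
  have hdeg : ∀ q : R, Prime q → 0 < q.totalDegree := fun q hq => by
    by_contra! h
    rw [Nat.le_zero, MvPolynomial.totalDegree_eq_zero_iff_eq_C] at h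
    apply hq.not_isUnit
    rw [h]
    refine (IsUnit.mk0 _ fun h0 => hq.ne_zero ?_).map MvPolynomial.C
    rw [h, h0, map_zero]
  choose v hv hvq using fun P : Q => exists_absoluteValue_multiplicity (F := F) (hQ P)
    (Real.exp_pos (-((Quot.out P.1).totalDegree : ℝ))) (Real.exp_le_one_iff.2 (by simp))
  obtain ⟨w, hw, hwd⟩ := exists_absoluteValue_totalDegree (B := B) (k := k) (F := F)
  let V : Option Q → AbsoluteValue F ℝ := fun o => o.elim w v
  have hunit : ∀ f : R, IsUnit f → ∀ i, V i (algebraMap R F f) = 1 := by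
    intro f hf i
    cases i with
    | none =>
      show w (algebraMap R F f) = 1
      rw [hwd f hf.ne_zero]
      obtain ⟨r, -, rfl⟩ := MvPolynomial.isUnit_iff_eq_C_of_isReduced.1 hf
      simp
    | some P =>
      show v P (algebraMap R F f) = 1
      rw [hvq P f hf.ne_zero, multiplicity_eq_zero.2 fun h =>
        (hQ P).not_isUnit (isUnit_of_dvd_unit h hf), pow_zero]
  have hprime : ∀ q : R, Prime q → HasProductFormula V (algebraMap R F q) := by
    intro q hq
    let P : Q := ⟨Associates.mk q, Associates.irreducible_mk.2 hq.irreducible⟩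
    have hass : Associated (Quot.out P.1) q :=
      Associates.mk_eq_mk_iff_associated.1 (by rw [Associates.quot_out])
    have h1 : ∀ P' : Q, P' ≠ P → v P' (algebraMap R F q) = 1 := fun P' hP' => by
      rw [hvq P' q hq.ne_zero, multiplicity_eq_zero.2 fun h => hP' ?_, pow_zero]
      have := ((hQ P').associated_of_dvd hq h)
      apply Subtype.ext
      rw [← Associates.quot_out P'.1]
      exact Associates.mk_eq_mk_iff_associated.2 this
    have hdegeq : (Quot.out P.1).totalDegree = q.totalDegree := by
      obtain ⟨u, hu⟩ := hass
      obtain ⟨r, hr, hur⟩ := MvPolynomial.isUnit_iff_eq_C_of_isReduced.1 u.isUnit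
      rw [← hu, MvPolynomial.totalDegree_mul_of_isDomain (hQ P).ne_zero u.ne_zero, hur,
        MvPolynomial.totalDegree_C, add_zero]
    have h2 : Real.log (v P (algebraMap R F q)) = -q.totalDegree := by
      rw [hvq P q hq.ne_zero, ← multiplicity_eq_of_associated_right hass, multiplicity_self,
        pow_one, Real.log_exp, hdegeq]
    have h3 : Real.log (w (algebraMap R F q)) = q.totalDegree := by
      rw [hwd q hq.ne_zero, Real.log_exp]
    have hsub : {i | V i (algebraMap R F q) ≠ 1} ⊆ (({none, some P} : Finset (Option Q)) : Set _) := by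
      intro i hi
      cases i with
      | none => simp
      | some P' =>
        by_cases hP' : P' = P
        · simp [hP']
        · exact absurd (h1 P' hP') hi
    refine ⟨(Finset.finite_toSet _).subset hsub, ?_⟩
    rw [finsum_eq_sum_of_support_subset (s := {none, some P}) _
      (fun i hi => hsub fun h => hi (by simp [h])), Finset.sum_pair (by simp)]
    show Real.log (w _) + Real.log (v P _) = 0
    rw [h2, h3, add_neg_cancel]
  have hpoly : ∀ f : R, f ≠ 0 → HasProductFormula V (algebraMap R F f) := by
    intro f
    refine UniqueFactorizationMonoid.induction_on_prime f (fun h => absurd rfl h)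
      (fun u hu _ => ?_) (fun a q ha hq ih hqa => ?_)
    · have := hunit u hu
      exact ⟨by simp [this], by simp [this]⟩
    · rw [map_mul]
      refine (hprime q hq).mul (ih ha) ?_ ?_
      · simpa using hq.ne_zero
      · simpa using ha
  refine ⟨Option Q, V, ?_, ?_, ?_⟩
  · rintro (_ | P)
    · exact hw
    · exact hv P
  · intro x hx
    obtain ⟨a, b, hb, rfl⟩ := IsFractionRing.div_surjective (A := R) x
    have ha0 : algebraMap R F a ≠ 0 := fun h => hx (by rw [h, zero_div])
    have hb0 : algebraMap R F b ≠ 0 := fun h => hx (by rw [h, div_zero])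
    rw [div_eq_mul_inv]
    exact (hpoly a fun h => ha0 (by simp [h])).mul (hpoly b fun h => hb0 (by simp [h])).inv ha0
      (inv_ne_zero hb0)
  · intro x hx
    by_cases hx0 : x = 0
    · exact ⟨0, by simp [hx0]⟩
    have hred := IsFractionRing.num_den_reduced R x
    have hmk : algebraMap R F (IsFractionRing.num R x) /
        algebraMap R F (IsFractionRing.den R x) = x := by
      exact IsFractionRing.mk'_num_den' R x
    set a := IsFractionRing.num R x
    set b : R := (IsFractionRing.den R x : R)
    have hb0 : b ≠ 0 := nonZeroDivisors.ne_zero (IsFractionRing.den R x).2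
    have ha0 : a ≠ 0 := fun h => hx0 (by rw [← hmk, h]; simp)
    have hbu : IsUnit b := by
      by_contra hbu
      obtain ⟨q, hq, hqb⟩ := WfDvdMonoid.exists_irreducible_factor hbu hb0
      let P : Q := ⟨Associates.mk q, Associates.irreducible_mk.2 hq⟩
      have hass : Associated (Quot.out P.1) q :=
        Associates.mk_eq_mk_iff_associated.1 (by rw [Associates.quot_out])
      have hPb : (Quot.out P.1) ∣ b := hass.dvd.trans hqb
      have hPa : ¬ (Quot.out P.1) ∣ a := fun h => (hQ P).not_isUnit (hred h hPb)
      have h1 := hx (some P)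
      change v P x ≤ 1 at h1
      rw [← hmk, map_div₀, hvq P a ha0, hvq P b hb0, multiplicity_eq_zero.2 hPa, pow_zero,
        div_le_one (by positivity)] at h1
      have h2 : multiplicity (Quot.out P.1) b ≠ 0 := fun h => multiplicity_eq_zero.1 h hPb
      refine absurd h1 (not_le.2 (pow_lt_one₀ (Real.exp_pos _).le ?_ h2))
      rw [Real.exp_lt_one_iff, neg_lt_zero]
      exact_mod_cast hdeg _ (hQ P)
    have h1 := hx none
    change w x ≤ 1 at h1
    obtain ⟨r, hr, hbr⟩ := MvPolynomial.isUnit_iff_eq_C_of_isReduced.1 hbu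
    rw [← hmk, map_div₀, hwd a ha0, hwd b hb0, hbr, MvPolynomial.totalDegree_C, Nat.cast_zero,
      Real.exp_zero, div_one, Real.exp_le_one_iff] at h1
    have h2 : a.totalDegree = 0 := by
      have : (a.totalDegree : ℝ) = 0 := le_antisymm h1 (by positivity)
      exact_mod_cast this
    rw [MvPolynomial.totalDegree_eq_zero_iff_eq_C] at h2
    refine ⟨MvPolynomial.coeff 0 a / r, ?_⟩
    have hr0 := hr.ne_zero
    rw [← hmk, div_eq_iff (by simpa using hb0), ← map_mul, hbr, ← MvPolynomial.C_mul,
      div_mul_cancel₀ _ hr0, ← h2]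

/-! ### Extension of places to algebraic extensions -/

theorem UniformSpace.Completion.isUltrametricDist {X : Type*} [PseudoMetricSpace X]
    (h : ∀ x y z : X, dist x z ≤ max (dist x y) (dist y z)) :
    IsUltrametricDist (UniformSpace.Completion X) := by
  refine ⟨fun x y z => ?_⟩
  induction x, y, z using UniformSpace.Completion.induction_on₃ with
  | hp => exact isClosed_le (by fun_prop) (by fun_prop)
  | ih a b c => simpa only [UniformSpace.Completion.dist_eq] using h a b c

universe u in
/-- A nonarchimedean absolute value extends to some algebraically closed extension field. -/
theorem AbsoluteValue.exists_extension_isAlgClosed {F : Type u} [Field F] (v : AbsoluteValue F ℝ)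
    (hv : IsNonarchimedean v) :
    ∃ (E : Type u) (_ : Field E) (_ : Algebra F E) (_ : IsAlgClosed E) (w : AbsoluteValue E ℝ),
      IsNonarchimedean w ∧ ∀ x, w (algebraMap F E x) = v x := by
  classical
  -- The spectral norm over the completion needs a nontrivial absolute value; a trivial one is
  -- extended trivially.
  by_cases htriv : ∃ x, 1 < v x
  · obtain ⟨x₀, hx₀⟩ := htriv
    have hdist : ∀ x y : WithAbs v, dist x y = v (WithAbs.ofAbs x - WithAbs.ofAbs y) := fun x y => by
      rw [dist_eq_norm]; rfl
    have hultra : IsUltrametricDist v.Completion := by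
      refine UniformSpace.Completion.isUltrametricDist fun x y z => ?_
      rw [hdist, hdist, hdist]
      refine le_trans (le_of_eq ?_) (hv _ _)
      congr 1; ring
    let _ : NontriviallyNormedField v.Completion :=
      { (inferInstance : NormedField v.Completion) with
        non_trivial := ⟨((WithAbs.toAbs v x₀ : WithAbs v) : v.Completion), by
          rw [UniformSpace.Completion.norm_coe]; exact hx₀⟩ }
    let e : F →+* v.Completion :=
      (UniformSpace.Completion.coeRingHom (α := WithAbs v)).comp
        (WithAbs.equiv v).symm.toRingHom
    have he : ∀ x, ‖e x‖ = v x := fun x => by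
      show ‖((WithAbs.toAbs v x : WithAbs v) : v.Completion)‖ = _
      rw [UniformSpace.Completion.norm_coe]; rfl
    let Ω := AlgebraicClosure v.Completion
    let _ : Algebra F Ω := ((algebraMap v.Completion Ω).comp e).toAlgebra
    let N := spectralMulAlgNorm v.Completion Ω
    refine ⟨Ω, inferInstance, inferInstance, inferInstance,
      { toFun := fun x => N x
        map_mul' := fun x y => map_mul N x y
        nonneg' := fun x => apply_nonneg N x
        eq_zero' := fun x => ⟨fun h => eq_zero_of_map_eq_zero N h, fun h => by rw [h, map_zero]⟩
        add_le' := fun x y => map_add_le_add N x y }, ?_, fun x => ?_⟩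
    · exact isNonarchimedean_spectralNorm (K := v.Completion) (L := Ω)
    · show spectralNorm v.Completion Ω (algebraMap v.Completion Ω (e x)) = v x
      rw [spectralNorm_extends, he]
  · push Not at htriv
    have h1 : ∀ x, x ≠ 0 → v x = 1 := fun x hx => by
      refine le_antisymm (htriv x) ?_
      have := htriv x⁻¹
      rw [map_inv₀] at this
      exact (inv_le_one₀ (v.pos hx)).1 this
    refine ⟨AlgebraicClosure F, inferInstance, inferInstance, inferInstance, AbsoluteValue.trivial,
      ?_, fun x => ?_⟩
    · intro x y
      by_cases hx : x = 0
      · simp [hx]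
      by_cases hxy : x + y = 0
      · rw [hxy, map_zero]; exact (AbsoluteValue.nonneg _ _).trans (le_max_left _ _)
      · rw [AbsoluteValue.trivial_apply hxy, AbsoluteValue.trivial_apply hx]
        exact le_max_left _ _
    · by_cases hx : x = 0
      · simp [hx]
      · rw [h1 x hx, AbsoluteValue.trivial_apply (by simpa using hx)]

section

open Polynomial

variable {F E : Type*} [Field F] [Field E] [Algebra F E] {w : AbsoluteValue E ℝ}

theorem AbsoluteValue.apply_le_one_of_aeval_eq_zero (hw : IsNonarchimedean w) {P : F[X]}
    (hP : P.Monic) (hc : ∀ j, w (algebraMap F E (P.coeff j)) ≤ 1) {x : E} (hx : aeval x P = 0) :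
    w x ≤ 1 := by
  by_contra! h
  rw [aeval_eq_sum_range, Finset.sum_range_succ, hP.coeff_natDegree, one_smul] at hx
  rcases Nat.eq_zero_or_pos P.natDegree with h0 | hpos
  · simp [h0] at hx
  have h1 : w (∑ j ∈ Finset.range P.natDegree, P.coeff j • x ^ j) ≤ w x ^ (P.natDegree - 1) := by
    refine apply_sum_le_of_isNonarchimedean hw (by positivity) _ _ fun j hj => ?_
    rw [Algebra.smul_def, map_mul, map_pow]
    have hj' := Finset.mem_range.1 hj
    calc w (algebraMap F E (P.coeff j)) * w x ^ j ≤ 1 * w x ^ (P.natDegree - 1) := by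
          gcongr
          · exact hc j
          · exact h.le
          · omega
      _ = _ := one_mul _
  rw [eq_neg_of_add_eq_zero_left hx, w.map_neg, map_pow] at h1
  exact absurd h1 (not_le.2 (pow_lt_pow_right₀ h (by omega)))

/-- The elements of absolute value at most one, for a nonarchimedean absolute value. -/
def AbsoluteValue.unitBall (w : AbsoluteValue E ℝ) (hw : IsNonarchimedean w) : Subring E where
  carrier := {x | w x ≤ 1}
  mul_mem' {a b} ha hb := by
    show w (a * b) ≤ 1
    rw [map_mul]; exact mul_le_one₀ ha (w.nonneg _) hb
  one_mem' := (map_one w).le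
  add_mem' {a b} ha hb := (hw a b).trans (max_le ha hb)
  zero_mem' := by simp
  neg_mem' {a} ha := by
    show w (-a) ≤ 1
    rw [w.map_neg]; exact ha

/-- P splits into factors X - a with a in the subring `unitBall`, so its coefficients lie there too.
-/
theorem AbsoluteValue.coeff_le_one_of_forall_roots [IsAlgClosed E] (hw : IsNonarchimedean w)
    {P : F[X]} (hP : P.Monic) (h : ∀ x : E, aeval x P = 0 → w x ≤ 1) (j : ℕ) :
    w (algebraMap F E (P.coeff j)) ≤ 1 := by
  have hmonic : (P.map (algebraMap F E)).Monic := hP.map _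
  have hlift : P.map (algebraMap F E) ∈ lifts (w.unitBall hw).subtype := by
    rw [(IsAlgClosed.splits (P.map (algebraMap F E))).eq_prod_roots_of_monic hmonic]
    refine multiset_prod_mem _ fun q hq => ?_
    obtain ⟨a, ha, rfl⟩ := Multiset.mem_map.1 hq
    have ha1 : w a ≤ 1 := h a (by
      have := (mem_roots hmonic.ne_zero).1 ha
      rwa [IsRoot.def, eval_map_algebraMap] at this)
    exact ⟨X - C ⟨a, ha1⟩, by simp⟩
  obtain ⟨q, hq⟩ := hlift
  rw [← coeff_map, ← hq]
  simp only [coe_mapRingHom, coeff_map]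
  exact (q.coeff j).2

end

section

open Polynomial

theorem HasProductFormula.of_pow {K M : Type*} [Field K] {v : M → AbsoluteValue K ℝ} {x : K}
    {n : ℕ} (hn : n ≠ 0) (h : HasProductFormula v (x ^ n)) : HasProductFormula v x := by
  refine ⟨h.1.subset fun i hi hi' => hi ?_, ?_⟩
  · rw [map_pow] at hi'
    exact (pow_eq_one_iff_of_nonneg ((v i).nonneg x) hn).1 hi'
  · have h2 := h.2
    simp only [map_pow, Real.log_pow] at h2
    rw [← mul_finsum] at h2
    · exact (mul_eq_zero.1 h2).resolve_left (by exact_mod_cast hn)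

theorem exists_pow_eq_one_of_isIntegral {k K : Type*} [Field k] [Finite k] [Field K] [Algebra k K]
    {x : K} (hx : IsIntegral k x) (h0 : x ≠ 0) : ∃ n : ℕ, 0 < n ∧ x ^ n = 1 := by
  have : FiniteDimensional k (IntermediateField.adjoin k {x}) :=
    IntermediateField.adjoin.finiteDimensional hx
  have : Finite (IntermediateField.adjoin k {x}) := Module.finite_of_finite k
  have := Fintype.ofFinite (IntermediateField.adjoin k {x})
  let y : IntermediateField.adjoin k {x} := ⟨x, IntermediateField.mem_adjoin_simple_self k x⟩
  have hy : y ≠ 0 := fun h => h0 (congrArg Subtype.val h)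
  have hcard := Fintype.one_lt_card (α := IntermediateField.adjoin k {x})
  exact ⟨_, by omega, congrArg Subtype.val (FiniteField.pow_card_sub_one_eq_one y hy)⟩

universe uF uK uI

variable {F : Type uF} {K : Type uK} {I : Type uI} [Field F] [Field K] [Algebra F K] [Algebra.IsAlgebraic F K]

/-- Extension of a product formula along a finite separable extension `L` of `F` inside an
algebraic extension `K`. The places are pairs of a place of `F` and an embedding of `L`. -/
theorem exists_product_formula_of_isSeparable {v : I → AbsoluteValue F ℝ}
    (hv : ∀ i, IsNonarchimedean (v i)) (hpf : ∀ x : F, x ≠ 0 → HasProductFormula v x)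
    (L : IntermediateField F K) [FiniteDimensional F L] [Algebra.IsSeparable F L] :
    ∃ (M : Type (max uF uK uI)) (V : M → AbsoluteValue K ℝ), (∀ m, IsNonarchimedean (V m)) ∧
      (∀ x ∈ L, x ≠ 0 → HasProductFormula V x) ∧
      ∀ x ∈ L, (∀ m, V m x ≤ 1) → ∀ i j, v i ((minpoly F x).coeff j) ≤ 1 := by
  classical
  choose E hE hFE hac w hw hwv using fun i => (v i).exists_extension_isAlgClosed (hv i)
  have hlift : ∀ i (σ : L →ₐ[F] E i), ∃ τ : K →ₐ[F] E i, ∀ x : L, τ x = σ x := by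
    intro i σ
    let _ : Algebra L (E i) := σ.toRingHom.toAlgebra
    have : IsScalarTower F L (E i) := IsScalarTower.of_algebraMap_eq fun x => (σ.commutes x).symm
    have : Algebra.IsAlgebraic L K := Algebra.IsAlgebraic.tower_top (K := F) L
    let τ : K →ₐ[L] E i := IsAlgClosed.lift
    exact ⟨τ.restrictScalars F, fun x => τ.commutes x⟩
  choose τ hτ using hlift
  let M := Σ i, (L →ₐ[F] E i)
  let V : M → AbsoluteValue K ℝ := fun m => (w m.1).comp (τ m.1 m.2).injective
  have hV : ∀ i (σ : L →ₐ[F] E i) (x : L), V ⟨i, σ⟩ x = w i (σ x) := fun i σ x => by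
    show w i (τ i σ x) = _
    rw [hτ]
  have hint : ∀ x : L, IsIntegral F x := fun x => Algebra.IsIntegral.isIntegral x
  -- Away from the places where a nonzero coefficient of the minimal polynomial has absolute value
  -- different from 1, every conjugate is integral.
  have hbad : ∀ x : L, {i | ∃ σ : L →ₐ[F] E i, 1 < w i (σ x)}.Finite := by
    intro x
    have hfin : (⋃ j ∈ (minpoly F x).support, {i | v i ((minpoly F x).coeff j) ≠ 1}).Finite :=
      Set.Finite.biUnion (Finset.finite_toSet _) fun j hj => (hpf _ (mem_support_iff.1 hj)).1
    refine hfin.subset ?_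
    rintro i ⟨σ, hσ⟩
    by_contra hi
    simp only [Set.mem_iUnion, Set.mem_ofPred_eq, not_exists, not_not] at hi
    refine absurd hσ (not_lt.2 ?_)
    refine AbsoluteValue.apply_le_one_of_aeval_eq_zero (hw i) (minpoly.monic (hint x))
      (fun j => ?_) (show aeval (σ x) (minpoly F x) = 0 by
        rw [aeval_algHom_apply, minpoly.aeval, map_zero])
    rw [hwv]
    by_cases hj : (minpoly F x).coeff j = 0
    · simp [hj]
    · exact (hi j (mem_support_iff.2 hj)).le
  refine ⟨M, V, fun m x y => ?_, ?_, ?_⟩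
  · show w m.1 (τ m.1 m.2 (x + y)) ≤ _
    rw [map_add]
    exact hw m.1 _ _
  · intro x hxL hx0
    lift x to L using hxL
    have hx0' : x ≠ 0 := fun h => hx0 (by simp [h])
    have hJfin := (hbad x).union (hbad x⁻¹)
    set J := hJfin.toFinset with hJ
    have hone : ∀ i ∉ J, ∀ σ : L →ₐ[F] E i, w i (σ x) = 1 := by
      intro i hi σ
      have hpos : 0 < w i (σ x) := (w i).pos (by simpa using hx0')
      rw [hJ, Set.Finite.mem_toFinset, Set.mem_union, not_or] at hi
      refine le_antisymm (not_lt.1 fun h => hi.1 ⟨σ, h⟩) (not_lt.1 fun h => hi.2 ⟨σ, ?_⟩)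
      rw [map_inv₀, map_inv₀]
      exact (one_lt_inv₀ hpos).2 h
    have hsub : {m | V m x ≠ 1} ⊆ ((J.sigma fun i => (Finset.univ : Finset (L →ₐ[F] E i)) : Finset M) : Set M) := by
      rintro ⟨i, σ⟩ hm
      rw [Finset.mem_coe, Finset.mem_sigma]
      refine ⟨?_, Finset.mem_univ _⟩
      by_contra hi
      exact hm (by rw [hV]; exact hone i hi σ)
    refine ⟨(Finset.finite_toSet _).subset hsub, ?_⟩
    rw [finsum_eq_sum_of_support_subset _ (s := J.sigma fun i => (Finset.univ : Finset (L →ₐ[F] E i)))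
      (fun m hm => hsub fun h => hm (by simp [h])), Finset.sum_sigma]
    -- By separability the norm is the product over the embeddings, which reduces the product
    -- formula on L to the one on F.
    have hnorm : ∀ i, ∑ σ : L →ₐ[F] E i, Real.log (V ⟨i, σ⟩ x) =
        Real.log (v i (Algebra.norm F x)) := by
      intro i
      simp_rw [hV]
      rw [← Real.log_prod (fun σ _ => (w i).ne_zero (by simpa using hx0')), ← map_prod,
        ← Algebra.norm_eq_prod_embeddings F (E i) x, hwv]
    simp_rw [hnorm]
    have hN0 : Algebra.norm F x ≠ 0 := Algebra.norm_ne_zero_iff.2 hx0'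
    rw [← (hpf _ hN0).2]
    symm
    refine finsum_eq_sum_of_support_subset _ fun i hi => ?_
    by_contra hiJ
    refine hi ?_
    show Real.log (v i (Algebra.norm F x)) = 0
    rw [← hnorm]
    exact Finset.sum_eq_zero fun σ _ => by rw [hV, hone i hiJ σ, Real.log_one]
  · intro x hxL h i j
    lift x to L using hxL
    have hmin : minpoly F (x : K) = minpoly F x := minpoly.algebraMap_eq (algebraMap L K).injective x
    rw [hmin, ← hwv]
    refine AbsoluteValue.coeff_le_one_of_forall_roots (hw i) (minpoly.monic (hint x))
      (fun y hy => ?_) j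
    obtain ⟨σ, rfl⟩ : ∃ σ : L →ₐ[F] E i, σ x = y := by
      have := Algebra.IsAlgebraic.range_eval_eq_rootSet_minpoly (F := F) (K := L) (E i) x
      have hy' : y ∈ (minpoly F x).rootSet (E i) :=
        (mem_rootSet_of_ne (minpoly.ne_zero (hint x))).2 hy
      rw [← this] at hy'
      exact hy'
    rw [← hV]
    exact h _

/-- Extension of a proper family of absolute values along an algebraic extension. -/
theorem exists_isProperFamily_of_isAlgebraic {k : Type*} [Field k] [Finite k] [Algebra k F]
    [Algebra k K] [IsScalarTower k F K] (q : ℕ) [ExpChar F q] {v : I → AbsoluteValue F ℝ}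
    (hv : ∀ i, IsNonarchimedean (v i)) (hpf : ∀ x : F, x ≠ 0 → HasProductFormula v x)
    (hconst : ∀ x : F, (∀ i, v i x ≤ 1) → ∃ c : k, x = algebraMap k F c) (T : Finset K) :
    ∃ (M : Type (max uF uK uI)) (V : M → AbsoluteValue K ℝ) (L : Subfield K),
      IsProperFamily V L ∧ (∀ c : k, algebraMap k K c ∈ L) ∧ ∀ t ∈ T, t ∈ L := by
  classical
  have hpow : ∀ t : K, ∃ n : ℕ, t ^ q ^ n ∈ separableClosure F K := fun t => by
    have : ExpChar (separableClosure F K) q :=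
      expChar_of_injective_algebraMap (algebraMap F (separableClosure F K)).injective q
    obtain ⟨n, y, hy⟩ := IsPurelyInseparable.pow_mem (separableClosure F K) q t
    exact ⟨n, by rw [← hy]; exact y.2⟩
  choose e he using hpow
  let T' : Finset K := T.image fun t => t ^ q ^ e t
  let L₀ : IntermediateField F K := IntermediateField.adjoin F (T' : Set K)
  have hfd : FiniteDimensional F L₀ :=
    IntermediateField.finiteDimensional_adjoin fun x _ => Algebra.IsIntegral.isIntegral x
  have hsep : Algebra.IsSeparable F L₀ := by
    refine (IntermediateField.isSeparable_adjoin_iff_isSeparable F K).2 fun x hx => ?_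
    obtain ⟨t, -, rfl⟩ := Finset.mem_image.1 (Finset.mem_coe.1 hx)
    exact mem_separableClosure_iff.1 (he t)
  obtain ⟨M, V, hV, hVpf, hVmin⟩ := exists_product_formula_of_isSeparable hv hpf L₀
  have : ExpChar L₀ q := expChar_of_injective_algebraMap (algebraMap F L₀).injective q
  have hq : q ≠ 0 := (expChar_pos F q).ne'
  -- The inseparable part is absorbed here: the product formula for a power of x implies it for x.
  have hL : ∀ {x : K}, x ∈ (perfectClosure L₀ K).toSubfield ↔ ∃ n : ℕ, x ^ q ^ n ∈ L₀ := by
    intro x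
    refine (mem_perfectClosure_iff_pow_mem q).trans (exists_congr fun n => ?_)
    exact ⟨fun ⟨y, hy⟩ => hy ▸ y.2, fun h => ⟨⟨_, h⟩, rfl⟩⟩
  have hprod : ∀ x ∈ (perfectClosure L₀ K).toSubfield, x ≠ 0 → HasProductFormula V x := by
    intro x hx h0
    obtain ⟨n, hn⟩ := hL.1 hx
    exact (hVpf _ hn (pow_ne_zero _ h0)).of_pow (pow_ne_zero n hq)
  refine ⟨M, V, (perfectClosure L₀ K).toSubfield, ⟨hV, fun hx h0 => (hprod _ hx h0).1,
    fun hx h0 => (hprod _ hx h0).2, fun {x} hx h0 h => ?_⟩, fun c => ?_, fun t ht => ?_⟩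
  · obtain ⟨n, hn⟩ := hL.1 hx
    have h1 : ∀ m, V m (x ^ q ^ n) ≤ 1 := fun m => by
      rw [map_pow]; exact pow_le_one₀ ((V m).nonneg _) (h m)
    have hint : IsIntegral F (x ^ q ^ n) := Algebra.IsIntegral.isIntegral _
    -- Coefficients bounded by 1 at all places of F are constants, so the element is algebraic over
    -- a finite field, hence a root of unity.
    have hlift : minpoly F (x ^ q ^ n) ∈ lifts (algebraMap k F) := by
      rw [lifts_iff_coeff_lifts]
      intro j
      obtain ⟨c, hc⟩ := hconst _ fun i => hVmin _ hn h1 i j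
      exact ⟨c, hc.symm⟩
    obtain ⟨P, hP, -, hPmonic⟩ := lifts_and_degree_eq_and_monic hlift (minpoly.monic hint)
    have hintk : IsIntegral k (x ^ q ^ n) := by
      refine ⟨P, hPmonic, ?_⟩
      rw [← aeval_def, ← aeval_map_algebraMap F, hP, minpoly.aeval]
    obtain ⟨m, hm, hm1⟩ := exists_pow_eq_one_of_isIntegral hintk (pow_ne_zero _ h0)
    exact ⟨q ^ n * m, Nat.mul_pos (pow_pos (Nat.pos_of_ne_zero hq) n) hm, by rw [pow_mul, hm1]⟩
  · refine hL.2 ⟨0, ?_⟩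
    rw [pow_zero, pow_one, IsScalarTower.algebraMap_apply k F K]
    exact L₀.algebraMap_mem _
  · exact hL.2 ⟨e t, IntermediateField.subset_adjoin F _
      (Finset.mem_coe.2 (Finset.mem_image_of_mem _ ht))⟩

end

open scoped IntermediateField.algebraAdjoinAdjoin in
universe u in
/-- Every finite subset of a field of positive characteristic is contained in a subfield with a
proper family of absolute values. -/
theorem exists_isProperFamily {K : Type u} [Field K] (p : ℕ) [Fact p.Prime] [Algebra (ZMod p) K]
    (T : Finset K) :
    ∃ (M : Type u) (V : M → AbsoluteValue K ℝ) (L : Subfield K),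
      IsProperFamily V L ∧ (∀ c : ZMod p, algebraMap (ZMod p) K c ∈ L) ∧ ∀ t ∈ T, t ∈ L := by
  obtain ⟨B, x, hx⟩ := exists_isTranscendenceBasis' (ZMod p) K
  let A := Algebra.adjoin (ZMod p) (Set.range x)
  let F := IntermediateField.adjoin (ZMod p) (Set.range x)
  let _ : Algebra A F := inferInstanceAs (Algebra
    (Algebra.adjoin (ZMod p) (Set.range x)) (IntermediateField.adjoin (ZMod p) (Set.range x)))
  have hfrac : IsFractionRing A F := inferInstanceAs (IsFractionRing
    (Algebra.adjoin (ZMod p) (Set.range x)) (IntermediateField.adjoin (ZMod p) (Set.range x)))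
  let e : MvPolynomial B (ZMod p) ≃ₐ[ZMod p] A := hx.1.aevalEquiv
  let _ : Algebra (MvPolynomial B (ZMod p)) F := ((algebraMap A F).comp e.toRingHom).toAlgebra
  have hfrac' : IsFractionRing (MvPolynomial B (ZMod p)) F := by
    have h := IsLocalization.isLocalization_of_base_ringEquiv (nonZeroDivisors A) F
      e.symm.toRingEquiv
    have h2 : (nonZeroDivisors A).map (e.symm.toRingEquiv : A ≃+* MvPolynomial B (ZMod p)) =
        nonZeroDivisors (MvPolynomial B (ZMod p)) :=
      MulEquivClass.map_nonZeroDivisors e.symm.toRingEquiv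
    rw [h2] at h
    exact h
  have : Algebra.IsAlgebraic F K := hx.isAlgebraic_field
  have : CharP (ZMod p) p := ZMod.charP p
  have : CharP F p := charP_of_injective_algebraMap (algebraMap (ZMod p) F).injective p
  have : ExpChar F p := ExpChar.prime Fact.out
  obtain ⟨I, v, hv, hpf, hconst⟩ := exists_product_formula_fractionField B (ZMod p) F
  refine exists_isProperFamily_of_isAlgebraic (k := ZMod p) p hv hpf (fun y hy => ?_) T
  obtain ⟨c, rfl⟩ := hconst y hy
  refine ⟨c, ?_⟩
  show algebraMap A F (e (MvPolynomial.C c)) = _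
  rw [← MvPolynomial.algebraMap_eq, AlgEquiv.commutes]
  rfl

/-! ### The gap principle for two solutions -/

section

open Polynomial

variable {K M : Type*} [Field K] {p : ℕ} [Fact p.Prime] [Algebra (ZMod p) K]
  {v : M → AbsoluteValue K ℝ} {L : Subfield K}

/-- The gap principle: if two solutions of `x + y = 1` point in nearly the same direction and are
not related by the Frobenius, then their heights are far apart up to powers of `p`, except for a
factor close to two. -/
theorem IsProperFamily.exists_pow_mul_logHt_le (hv : IsProperFamily v L)
    (hk : ∀ c : ZMod p, algebraMap (ZMod p) K c ∈ L) (S : Finset M) {x y s t : K}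
    (hxL : x ∈ L) (hyL : y ∈ L) (hsL : s ∈ L) (htL : t ∈ L)
    (hx : x ≠ 0) (hy : y ≠ 0) (hs : s ≠ 0) (ht : t ≠ 0) (hxy : x + y = 1) (hst : s + t = 1)
    (hxS : ∀ i ∉ S, v i x = 1) (hyS : ∀ i ∉ S, v i y = 1)
    (hsS : ∀ i ∉ S, v i s = 1) (htS : ∀ i ∉ S, v i t = 1)
    (hne : ∀ k : ℕ, s ≠ x ^ p ^ k) {h₁ h₂ : ℝ}
    (hh₁ : h₁ = logHt S (fun i => Real.log (v i x)) (fun i => Real.log (v i y)))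
    (hh₂ : h₂ = logHt S (fun i => Real.log (v i s)) (fun i => Real.log (v i t)))
    (hpos : 0 < h₁) (hle : h₁ ≤ h₂)
    (hclose : ∑ i ∈ S, max |h₂⁻¹ * Real.log (v i s) - h₁⁻¹ * Real.log (v i x)|
      (max |h₂⁻¹ * Real.log (v i t) - h₁⁻¹ * Real.log (v i y)|
        |(h₂⁻¹ * Real.log (v i s) - h₁⁻¹ * Real.log (v i x)) -
          (h₂⁻¹ * Real.log (v i t) - h₁⁻¹ * Real.log (v i y))|) ≤ 1 / 3) :
    3 < p ∧ ∃ k : ℕ, 16 / 9 * p ^ k * h₁ ≤ h₂ ∧ h₂ ≤ 9 / 4 * p ^ k * h₁ := by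
  have hpp : p.Prime := Fact.out
  have hcharK : CharP K p := charP_of_injective_algebraMap (algebraMap (ZMod p) K).injective p
  have hpos₂ : 0 < h₂ := hpos.trans_le hle
  set lx : M → ℝ := fun i => Real.log (v i x) with hlx
  set ly : M → ℝ := fun i => Real.log (v i y) with hly
  set ls : M → ℝ := fun i => Real.log (v i s) with hls
  set lt : M → ℝ := fun i => Real.log (v i t) with hlt
  have sx : ∑ i ∈ S, lx i = 0 := hv.sum_log_eq_zero S hxL hx hxS
  have sy : ∑ i ∈ S, ly i = 0 := hv.sum_log_eq_zero S hyL hy hyS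
  have ss : ∑ i ∈ S, ls i = 0 := hv.sum_log_eq_zero S hsL hs hsS
  have st : ∑ i ∈ S, lt i = 0 := hv.sum_log_eq_zero S htL ht htS
  have szero : ∀ (c : ℝ) (f : M → ℝ), ∑ i ∈ S, f i = 0 → ∑ i ∈ S, (c • f) i = 0 := by
    intro c f hf
    simp only [Pi.smul_apply, smul_eq_mul, ← Finset.mul_sum, hf, mul_zero]
  have n₁ : logHt S (h₁⁻¹ • lx) (h₁⁻¹ • ly) = 1 := by
    rw [logHt_smul S (by positivity), ← hh₁, inv_mul_cancel₀ hpos.ne']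
  have n₂ : logHt S (h₂⁻¹ • ls) (h₂⁻¹ • lt) = 1 := by
    rw [logHt_smul S (by positivity), ← hh₂, inv_mul_cancel₀ hpos₂.ne']
  have hδ : logHt S (h₂⁻¹ • ls - h₁⁻¹ • lx) (h₂⁻¹ • lt - h₁⁻¹ • ly) ≤ 2 / 9 := by
    have h0 : ∀ f g : M → ℝ, ∑ i ∈ S, f i = 0 → ∑ i ∈ S, g i = 0 →
        ∑ i ∈ S, (h₂⁻¹ • f - h₁⁻¹ • g) i = 0 := fun f g hf hg => by
      simp only [Pi.sub_apply, Finset.sum_sub_distrib, szero _ _ hf, szero _ _ hg, sub_zero]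
    refine (logHt_le_of_sum_eq_zero S (h0 _ _ ss sx) (h0 _ _ st sy)).trans ?_
    -- Distance 1/3 in norm becomes 2/9 in height, the constant used by the numerical lemma.
    have : (2 / 9 : ℝ) = 2 / 3 * (1 / 3) := by norm_num
    rw [this]
    gcongr
    exact hclose
  let X : ℝ → ℝ := fun c => logHt S (h₂ • h₂⁻¹ • ls - c • h₁⁻¹ • lx)
    (h₂ • h₂⁻¹ • lt - c • h₁⁻¹ • ly)
  have hX := fun c (hc : 0 ≤ c) => logHt_sub_smul_le S hpos₂.le hc
    (szero h₁⁻¹ lx sx) (szero h₁⁻¹ ly sy) n₁ n₂ hδ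
  have hXeq : ∀ (n k : ℕ), X (n * (p ^ k * h₁)) =
      logHt S (fun i => Real.log (v i s) - n * Real.log (v i (x ^ p ^ k)))
        (fun i => Real.log (v i t) - n * Real.log (v i (y ^ p ^ k))) := by
    intro n k
    simp only [X, smul_smul, mul_inv_cancel₀ hpos₂.ne', one_smul]
    rw [show (n * (p ^ k * h₁)) * h₁⁻¹ = (n * p ^ k : ℝ) by field_simp]
    congr 1 <;> funext i <;> simp [hlx, hly, hls, hlt, Real.log_pow] <;> ring
  have hfrob : ∀ k : ℕ, x ^ p ^ k + y ^ p ^ k = 1 := fun k => by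
    rw [← add_pow_char_pow, hxy, one_pow]
  have hhtpow : ∀ k : ℕ, logHt S (fun i => Real.log (v i (x ^ p ^ k)))
      (fun i => Real.log (v i (y ^ p ^ k))) = p ^ k * h₁ := by
    intro k
    rw [hh₁, ← logHt_smul S (by positivity)]
    congr 1 <;> funext i <;> simp [hlx, hly, Real.log_pow]
  have hSpow : ∀ {z : K} (k : ℕ), (∀ i ∉ S, v i z = 1) → ∀ i ∉ S, v i (z ^ p ^ k) = 1 :=
    fun k h i hi => by rw [map_pow, h i hi, one_pow]
  refine exists_pow_mul_le_of_gap hpp.one_lt hpos hle X (fun c hc => (hX c hc).1)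
    (fun c hc => (hX c (hpos₂.le.trans hc)).2 hc) (fun k => ?_) (fun k N hN => ?_)
  · have := hv.pade_dichotomy hk S (pow_mem hxL (p ^ k)) (pow_mem hyL (p ^ k)) hsL htL
      (pow_ne_zero _ hx) (pow_ne_zero _ hy) hs ht (hfrob k) hst (hSpow k hxS) (hSpow k hyS) hsS htS
      -- The trivial approximant X + (1 - X) - 1 = 0. Its degenerate case says s = x^(p^k), which
      -- `hne` forbids.
      (n := 1) (N := 0) (A := 1) (B := 1) (C := -1) (by simp) (by simp) (by simp) (by ring)
    rw [← hXeq, hhtpow] at this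
    rcases this with h | h
    · simpa using h
    · refine absurd ?_ (hne k)
      simpa using h
  · obtain ⟨A, B, C, hA, hB, hC, hrel, hA0, hcop⟩ := exists_pade (k := ZMod p) p N hN
    have := hv.pade_dichotomy hk S (pow_mem hxL (p ^ k)) (pow_mem hyL (p ^ k)) hsL htL
      (pow_ne_zero _ hx) (pow_ne_zero _ hy) hs ht (hfrob k) hst (hSpow k hxS) (hSpow k hyS) hsS htS
      hA.le hB hC hrel
    rw [← hXeq, hhtpow] at this
    push_cast at this
    refine this.imp (fun h => ?_) (fun h => ?_)
    · refine le_trans (le_of_eq ?_) h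
      ring
    · have hdeg := hv.natDegree_mul_logHt_le hk S (pow_mem hxL (p ^ k))
        (pow_ne_zero _ hx) (pow_ne_zero _ hy) hs ht (hfrob k) (hSpow k hxS) (hSpow k hyS) hsS htS
        (mul_ne_zero (pow_ne_zero _ X_ne_zero) hA0) hcop h
      rw [hhtpow, ← hh₂, natDegree_mul (pow_ne_zero _ X_ne_zero) hA0, natDegree_X_pow, hA] at hdeg
      refine le_trans (le_of_eq ?_) hdeg
      push_cast; ring

end

/-! ### Logarithmic embedding and the count -/

section

variable {K M : Type*} [Field K] {v : M → AbsoluteValue K ℝ} {L : Subfield K}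

/-- The logarithmic embedding of pairs of units at finitely many places. -/
noncomputable def logEmbedding (v : M → AbsoluteValue K ℝ) (S : Finset M) :
    Additive (Kˣ × Kˣ) →+ PiLp 1 (fun _ : S => ℝ × ℝ × ℝ) where
  toFun u := WithLp.toLp 1 fun i =>
    (Real.log (v i (u.toMul.1 : K)), Real.log (v i (u.toMul.2 : K)),
      Real.log (v i (u.toMul.1 : K)) - Real.log (v i (u.toMul.2 : K)))
  map_zero' := by ext i <;> simp
  map_add' u w := by
    have h : ∀ (i : M) (a b : Kˣ), Real.log (v i ((a * b : Kˣ) : K)) =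
        Real.log (v i a) + Real.log (v i b) := fun i a b => by
      rw [Units.val_mul, map_mul, Real.log_mul ((v i).ne_zero a.ne_zero) ((v i).ne_zero b.ne_zero)]
    ext i
    · exact h _ _ _
    · exact h _ _ _
    · simp only [toMul_add, Prod.snd_mul, Prod.fst_mul, h, PiLp.add_apply, Prod.snd_add]
      ring

theorem norm_smul_logEmbedding_sub (S : Finset M) (u w : Additive (Kˣ × Kˣ)) (c d : ℝ) :
    ‖c • logEmbedding v S u - d • logEmbedding v S w‖ =
      ∑ i ∈ S, max |c * Real.log (v i (u.toMul.1 : K)) - d * Real.log (v i (w.toMul.1 : K))|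
        (max |c * Real.log (v i (u.toMul.2 : K)) - d * Real.log (v i (w.toMul.2 : K))|
        |(c * Real.log (v i (u.toMul.1 : K)) - d * Real.log (v i (w.toMul.1 : K))) -
          (c * Real.log (v i (u.toMul.2 : K)) - d * Real.log (v i (w.toMul.2 : K)))|) := by
  rw [PiLp.norm_eq_of_L1, ← Finset.sum_coe_sort S]
  refine Finset.sum_congr rfl fun i _ => ?_
  simp only [logEmbedding, AddMonoidHom.coe_mk, ZeroHom.coe_mk, PiLp.sub_apply, PiLp.smul_apply,
    Prod.norm_def, Prod.fst_sub, Prod.snd_sub, Prod.smul_fst, Prod.smul_snd, smul_eq_mul,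
    Real.norm_eq_abs]
  congr 3
  ring

theorem IsProperFamily.exists_finset_forall_eq_one (hv : IsProperFamily v L)
    {G : Subgroup (Kˣ × Kˣ)} {s : Finset (Kˣ × Kˣ)} (hs : Subgroup.closure (s : Set _) = G)
    (hsL : ∀ u ∈ s, (u.1 : K) ∈ L ∧ (u.2 : K) ∈ L) :
    ∃ S : Finset M, ∀ u ∈ G, ((u.1 : K) ∈ L ∧ (u.2 : K) ∈ L) ∧
      ∀ i ∉ S, v i (u.1 : K) = 1 ∧ v i (u.2 : K) = 1 := by
  classical
  have hfin : (⋃ u ∈ s, ({i | v i (u.1 : K) ≠ 1} ∪ {i | v i (u.2 : K) ≠ 1})).Finite :=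
    Set.Finite.biUnion s.finite_toSet fun u hu =>
      (hv.finite (hsL u hu).1 u.1.ne_zero).union (hv.finite (hsL u hu).2 u.2.ne_zero)
  refine ⟨hfin.toFinset, fun u hu => ?_⟩
  rw [← hs] at hu
  induction hu using Subgroup.closure_induction with
  | mem u hu =>
    refine ⟨hsL u hu, fun i hi => ?_⟩
    simp only [Set.Finite.mem_toFinset, Set.mem_iUnion, Set.mem_union, Set.mem_ofPred_eq,
      not_exists, not_or, not_not] at hi
    exact hi u hu
  | one => simp [one_mem]
  | mul u w _ _ hu hw =>
    refine ⟨⟨mul_mem hu.1.1 hw.1.1, mul_mem hu.1.2 hw.1.2⟩, fun i hi => ?_⟩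
    simp [hu.2 i hi, hw.2 i hi]
  | inv u _ hu =>
    refine ⟨⟨by simpa using inv_mem hu.1.1, by simpa using inv_mem hu.1.2⟩, fun i hi => ?_⟩
    simp [hu.2 i hi]

theorem IsProperFamily.exists_pow_eq_one_of_logHt_le (hv : IsProperFamily v L) (S : Finset M)
    {x y : K} (hxL : x ∈ L) (hyL : y ∈ L) (hx : x ≠ 0) (hy : y ≠ 0) (hxS : ∀ i ∉ S, v i x = 1)
    (hyS : ∀ i ∉ S, v i y = 1)
    (h : logHt S (fun i => Real.log (v i x)) (fun i => Real.log (v i y)) ≤ 0) :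
    ∃ n : ℕ, 0 < n ∧ x ^ n = 1 ∧ y ^ n = 1 := by
  have h0 := (Finset.sum_eq_zero_iff_of_nonneg fun i _ => le_max_left _ _).1
    (le_antisymm h (logHt_nonneg S _ _))
  have hle : ∀ i, v i x ≤ 1 ∧ v i y ≤ 1 := fun i => by
    by_cases hi : i ∈ S
    · have := h0 i hi
      rw [max_eq_left_iff, max_le_iff] at this
      rwa [Real.log_nonpos_iff ((v i).nonneg _), Real.log_nonpos_iff ((v i).nonneg _)] at this
    · exact ⟨(hxS i hi).le, (hyS i hi).le⟩
  obtain ⟨n, hn, hxn⟩ := hv.exists_pow_eq_one hxL hx fun i => (hle i).1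
  obtain ⟨m, hm, hym⟩ := hv.exists_pow_eq_one hyL hy fun i => (hle i).2
  exact ⟨n * m, Nat.mul_pos hn hm, by rw [pow_mul, hxn, one_pow], by
    rw [mul_comm, pow_mul, hym, one_pow]⟩

end

/-- In characteristic `p`, an element of finite order is its own `p ^ k`-th power for some
positive `k`. -/
theorem exists_pow_pow_eq_self_of_pow_eq_one {K : Type*} [Field K] (p : ℕ) [Fact p.Prime]
    [CharP K p] {u : Kˣ × Kˣ} {n : ℕ} (hn : 0 < n) (hu : u ^ n = 1) :
    ∃ k : ℕ, u ^ p ^ (k + 1) = u := by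
  have hpp : p.Prime := Fact.out
  have hfin : IsOfFinOrder u := isOfFinOrder_iff_pow_eq_one.2 ⟨n, hn, hu⟩
  -- Frobenius is injective, so there is no `p`-torsion; Euler's theorem then gives p^φ(ord u) ≡ 1
  -- modulo the order.
  have hcop : p.Coprime (orderOf u) := by
    rw [hpp.coprime_iff_not_dvd]
    rintro ⟨m, hm⟩
    have hinj : ∀ a : Kˣ, a ^ p = 1 → a = 1 := fun a ha => by
      apply Units.ext
      have h1 : (a : K) ^ p = 1 ^ p := by
        rw [← Units.val_pow_eq_pow_val, ha, Units.val_one, one_pow]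
      exact frobenius_inj K p h1
    have h1 : (u ^ m) ^ p = 1 := by rw [← pow_mul, mul_comm, ← hm, pow_orderOf_eq_one]
    have h2 : u ^ m = 1 := Prod.ext (hinj _ (congrArg Prod.fst h1)) (hinj _ (congrArg Prod.snd h1))
    have hpos := hfin.orderOf_pos
    have hdvd := Nat.le_of_dvd (Nat.pos_of_ne_zero fun h => by simp [hm, h] at hpos)
      (orderOf_dvd_of_pow_eq_one h2)
    have hm0 : 0 < m := Nat.pos_of_ne_zero fun h => by simp [hm, h] at hpos
    have := hpp.two_le
    nlinarith
  refine ⟨(orderOf u).totient - 1, ?_⟩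
  rw [Nat.sub_add_cancel (Nat.totient_pos.2 hfin.orderOf_pos)]
  exact (pow_eq_pow_iff_modEq.2 (Nat.ModEq.pow_totient hcop)).trans (pow_one u)

theorem card_solutions_le {K : Type*} [Field K] (p : ℕ) [Fact p.Prime] [CharP K p]
    (G : Subgroup (Kˣ × Kˣ)) (hG : G.FG) (Z : Finset (Kˣ × Kˣ))
    (hZ : ∀ u ∈ Z, u ∈ G ∧ (u.1 : K) + (u.2 : K) = 1 ∧ u ∉ G.map (powMonoidHom p)) :
    Z.card ≤ 2 * 19 ^ Module.finrank ℚ (ℚ ⊗[ℤ] Additive G) := by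
  classical
  let _ : Algebra (ZMod p) K := ZMod.algebra K p
  have hGfg : Group.FG G := (Group.fg_iff_subgroup_fg G).2 hG
  obtain ⟨s, hs⟩ := hG
  obtain ⟨M, v, L, hv, hk, hT⟩ := exists_isProperFamily (K := K) p
    (s.image (fun u => (u.1 : K)) ∪ s.image (fun u => (u.2 : K)))
  obtain ⟨S, hS⟩ := hv.exists_finset_forall_eq_one hs fun u hu =>
    ⟨hT _ (Finset.mem_union_left _ (Finset.mem_image_of_mem _ hu)),
      hT _ (Finset.mem_union_right _ (Finset.mem_image_of_mem _ hu))⟩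
  have hmap : ∀ (k : ℕ) (u w : Kˣ × Kˣ), w ∈ G → u = w ^ p ^ (k + 1) →
      u ∈ G.map (powMonoidHom p) := fun k u w hw h =>
    ⟨w ^ p ^ k, pow_mem hw _, by rw [powMonoidHom_apply, ← pow_mul, ← pow_succ, h]⟩
  let h : Kˣ × Kˣ → ℝ := fun u =>
    logHt S (fun i => Real.log (v i (u.1 : K))) (fun i => Real.log (v i (u.2 : K)))
  have hpos : ∀ u ∈ Z, 0 < h u := fun u hu => by
    obtain ⟨huG, -, hup⟩ := hZ u hu
    by_contra! hle
    obtain ⟨⟨h1, h2⟩, h3⟩ := hS u huG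
    obtain ⟨n, hn, hx, hy⟩ := hv.exists_pow_eq_one_of_logHt_le S h1 h2 u.1.ne_zero u.2.ne_zero
      (fun i hi => (h3 i hi).1) (fun i hi => (h3 i hi).2) hle
    obtain ⟨k, hku⟩ := exists_pow_pow_eq_self_of_pow_eq_one p hn
      (show u ^ n = 1 from Prod.ext (Units.ext hx) (Units.ext hy))
    exact hup (hmap k u u huG hku.symm)
  -- The exclusion of `G^p` serves here a second time: a proper Frobenius power of a solution is a
  -- `p`-th power in G.
  have hfrob : ∀ u ∈ Z, ∀ w ∈ Z, u ≠ w → ∀ k : ℕ, (w.1 : K) ≠ (u.1 : K) ^ p ^ k := by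
    intro u hu w hw huw k hk'
    have hsnd : (w.2 : K) = (u.2 : K) ^ p ^ k := by
      have h1 := (hZ u hu).2.1
      have h2 := (hZ w hw).2.1
      have h3 : (u.1 : K) ^ p ^ k + (u.2 : K) ^ p ^ k = 1 := by
        rw [← add_pow_char_pow, h1, one_pow]
      rw [hk'] at h2
      exact add_left_cancel (h2.trans h3.symm)
    have heq : w = u ^ p ^ k := Prod.ext (Units.ext hk') (Units.ext hsnd)
    cases k with
    | zero => exact huw (by simpa using heq.symm)
    | succ k => exact (hZ w hw).2.2 (hmap k w u (hZ u hu).1 heq)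
  have hclose : ∀ u ∈ Z, ∀ w ∈ Z, u ≠ w → h u ≤ h w →
      ‖(h w)⁻¹ • logEmbedding v S (Additive.ofMul w) -
        (h u)⁻¹ • logEmbedding v S (Additive.ofMul u)‖ ≤ 1 / 3 →
      3 < p ∧ ∃ k : ℕ, 16 / 9 * p ^ k * h u ≤ h w ∧ h w ≤ 9 / 4 * p ^ k * h u := by
    intro u hu w hw huw hle hd
    obtain ⟨⟨u1, u2⟩, u3⟩ := hS u (hZ u hu).1
    obtain ⟨⟨w1, w2⟩, w3⟩ := hS w (hZ w hw).1
    rw [norm_smul_logEmbedding_sub] at hd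
    exact hv.exists_pow_mul_logHt_le hk S u1 u2 w1 w2 u.1.ne_zero u.2.ne_zero w.1.ne_zero
      w.2.ne_zero (hZ u hu).2.1 (hZ w hw).2.1 (fun i hi => (u3 i hi).1) (fun i hi => (u3 i hi).2)
      (fun i hi => (w3 i hi).1) (fun i hi => (w3 i hi).2) (hfrob u hu w hw huw) rfl rfl
      (hpos u hu) hle hd
  have htriple : ∀ u ∈ Z, ∀ w ∈ Z, ∀ z ∈ Z, u ≠ w → w ≠ z → u ≠ z → h u ≤ h w → h w ≤ h z →
      ¬ ∀ a ∈ ({u, w, z} : Finset (Kˣ × Kˣ)), ∀ b ∈ ({u, w, z} : Finset (Kˣ × Kˣ)),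
        ‖(h a)⁻¹ • logEmbedding v S (Additive.ofMul a) -
          (h b)⁻¹ • logEmbedding v S (Additive.ofMul b)‖ ≤ 1 / 3 := by
    intro u hu w hw z hz huw hwz huz h1 h2 hall
    obtain ⟨hp3, huw'⟩ := hclose u hu w hw huw h1 (hall _ (by simp) _ (by simp))
    exact not_three_ratios hp3 (hpos u hu) huw'
      (hclose w hw z hz hwz h2 (hall _ (by simp) _ (by simp))).2
      (hclose u hu z hz huz (h1.trans h2) (hall _ (by simp) _ (by simp))).2
  have : Module.Finite ℤ (Additive G) := Module.Finite.iff_addGroup_fg.2 inferInstance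
  let f : Additive G →+ PiLp 1 (fun _ : S => ℝ × ℝ × ℝ) :=
    (logEmbedding v S).comp (MonoidHom.toAdditive G.subtype)
  obtain ⟨hrank, hfd⟩ := finrank_span_range_le_finrank_rat_tensorProduct f
  let W := Submodule.span ℝ (Set.range f)
  let c : Z → W := fun u => ⟨(h u.1)⁻¹ • logEmbedding v S (Additive.ofMul u.1),
    Submodule.smul_mem _ _ (Submodule.subset_span ⟨Additive.ofMul ⟨u.1, (hZ _ u.2).1⟩, rfl⟩)⟩
  have hcsub : ∀ a b : Z, ‖c a - c b‖ = ‖(h a.1)⁻¹ • logEmbedding v S (Additive.ofMul a.1) -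
          (h b.1)⁻¹ • logEmbedding v S (Additive.ofMul b.1)‖ := fun a b => rfl
  have hnorm : ∀ u : Z, ‖c u‖ ≤ 3 := by
    intro u
    obtain ⟨⟨u1, u2⟩, u3⟩ := hS u.1 (hZ _ u.2).1
    have hp := hpos u.1 u.2
    have e : ‖c u‖ = (h u.1)⁻¹ * ‖logEmbedding v S (Additive.ofMul u.1)‖ := by
      show ‖(h u.1)⁻¹ • logEmbedding v S (Additive.ofMul u.1)‖ = _
      rw [norm_smul, Real.norm_of_nonneg (by positivity)]
    have e2 := norm_smul_logEmbedding_sub (v := v) S (Additive.ofMul u.1) (Additive.ofMul u.1) 1 0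
    simp only [one_smul, zero_smul, sub_zero, one_mul, zero_mul, toMul_ofMul] at e2
    have e3 := sum_max_abs_le S (hv.sum_log_eq_zero S u1 u.1.1.ne_zero fun i hi => (u3 i hi).1)
      (hv.sum_log_eq_zero S u2 u.1.2.ne_zero fun i hi => (u3 i hi).2)
    rw [← e2] at e3
    rw [e, inv_mul_le_iff₀ hp, mul_comm]
    exact e3
  have hpack := card_le_of_forall_card_ball_le (E := W) (Finset.univ : Finset Z) c
    -- Points whose balls of radius 1/6 share a point are within 1/3 of each other, so `htriple`
    -- allows at most two; 1 + 3/(1/6) = 19.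
    (R := 3) (ρ := 1 / 6) (by norm_num) (by norm_num) (fun u _ => hnorm u) 2 (by
      intro x T _ hT
      by_contra! hcard
      obtain ⟨a, ha, b, hb, d, hd, hab, had, hbd⟩ := Finset.two_lt_card.1 hcard
      have hdist : ∀ a ∈ T, ∀ b ∈ T, ‖(h a.1)⁻¹ • logEmbedding v S (Additive.ofMul a.1) -
          (h b.1)⁻¹ • logEmbedding v S (Additive.ofMul b.1)‖ ≤ 1 / 3 := by
        intro a ha b hb
        rw [← hcsub, ← dist_eq_norm]
        have h1 := Metric.mem_ball.1 (hT a ha)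
        have h2 := Metric.mem_ball.1 (hT b hb)
        have h3 := dist_triangle_left (c a) (c b) x
        linarith
      have hsort : ∀ a ∈ T, ∀ b ∈ T, ∀ d ∈ T, a ≠ b → b ≠ d → a ≠ d → h a.1 ≤ h b.1 →
          h b.1 ≤ h d.1 → False := by
        intro a ha b hb d hd hab hbd had h1 h2
        refine htriple a.1 a.2 b.1 b.2 d.1 d.2 (fun e => hab (Subtype.ext e))
          (fun e => hbd (Subtype.ext e)) (fun e => had (Subtype.ext e)) h1 h2 ?_
        intro y hy z hz
        have hmem : ∀ y ∈ ({a.1, b.1, d.1} : Finset (Kˣ × Kˣ)), ∃ t ∈ T, t.1 = y := by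
          intro y hy
          simp only [Finset.mem_insert, Finset.mem_singleton] at hy
          rcases hy with rfl | rfl | rfl
          exacts [⟨a, ha, rfl⟩, ⟨b, hb, rfl⟩, ⟨d, hd, rfl⟩]
        obtain ⟨y', hy', rfl⟩ := hmem y hy
        obtain ⟨z', hz', rfl⟩ := hmem z hz
        exact hdist y' hy' z' hz'
      rcases le_total (h a.1) (h b.1) with h1 | h1 <;>
      rcases le_total (h b.1) (h d.1) with h2 | h2 <;>
      rcases le_total (h a.1) (h d.1) with h3 | h3
      · exact hsort a ha b hb d hd hab hbd had h1 h2
      · exact hsort a ha b hb d hd hab hbd had h1 h2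
      · exact hsort a ha d hd b hb had hbd.symm hab h3 h2
      · exact hsort d hd a ha b hb had.symm hab hbd.symm h3 h1
      · exact hsort b hb a ha d hd hab.symm had hbd h1 h3
      · exact hsort b hb d hd a ha hbd had.symm hab.symm h2 h3
      · exact hsort d hd b hb a ha hbd.symm hab.symm had.symm h2 h1
      · exact hsort d hd b hb a ha hbd.symm hab.symm had.symm h2 h1)
  rw [Finset.card_univ, Fintype.card_coe, show (1 + 3 / (1 / 6) : ℝ) = 19 by norm_num] at hpack
  have hfinal : (Z.card : ℝ) ≤ 2 * 19 ^ Module.finrank ℚ (ℚ ⊗[ℤ] Additive G) :=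
    hpack.trans (by
      push_cast
      exact mul_le_mul_of_nonneg_left (pow_le_pow_right₀ (by norm_num) hrank) (by norm_num))
  exact_mod_cast hfinal

theorem theorem1p2 {K : Type*} [Field K] (p : ℕ) (hp : 0 < p) [CharP K p]
    (G : Subgroup (Kˣ × Kˣ)) (hG : G.FG) (r : ℕ)
    (hr : Module.finrank ℚ (ℚ ⊗[ℤ] Additive G) = r) :
    Set.encard {u : Kˣ × Kˣ | u ∈ G ∧ (u.1 : K) + (u.2 : K) = 1 ∧
      u ∉ G.map (powMonoidHom p)} ≤ 31 * 19 ^ r := by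
  have : Fact p.Prime := ⟨(CharP.char_is_prime_or_zero K p).resolve_right hp.ne'⟩
  by_contra! hlt
  obtain ⟨T, hTsub, hTcard⟩ := Set.exists_subset_encard_eq
    (k := ((2 * 19 ^ r + 1 : ℕ) : ℕ∞)) (le_of_lt (lt_of_le_of_lt (by
      have : 2 * 19 ^ r + 1 ≤ 31 * 19 ^ r := by
        have := Nat.one_le_pow r 19 (by norm_num); omega
      exact_mod_cast this) hlt))
  have hTfin : T.Finite := Set.finite_of_encard_eq_coe hTcard
  have hcard := card_solutions_le p G hG hTfin.toFinset fun u hu =>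
    hTsub (hTfin.mem_toFinset.1 hu)
  rw [hTfin.encard_eq_coe_toFinset_card] at hTcard
  rw [hr, Nat.cast_inj.1 hTcard] at hcard
  omega
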